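/- Let $k$ be a field and $V$ a finite-dimensional $k$-vector space with a totally ordered basis $X$. Let $c$ be an automorphism of $V\otimes V$ satisfying the braid equation $(c\otimes\mathrm{id})(\mathrm{id}\otimes c)(c\otimes\mathrm{id})=(\mathrm{id}\otimes c)(c\otimes\mathrm{id})(\mathrm{id}\otimes c)$, and assume that $c$ is right triangular with respect to $X$: for all $x,y\in X$ there are $\beta_{x,y}\in k$ and $w_{x,y,z}\in V$ ($z\in X$, $z>x$) with $$c(x\otimes y)=\beta_{x,y}\,y\otimes x+\sum_{z>x}w_{x,y,z}\otimes z .$$ Let $T(V,c)$ be the braided tensor bialgebra: the tensor algebra $T(V)$ with the braiding $\hat c$ induced by $c$ (given on $V^{\otimes n}\otimes V^{\otimes m}$ by $c_{n,m}$, where $c_{0,m}$ and $c_{n,0}$ are identities, $c_{1,1}=c$, $c_{1,m+1}=(\mathrm{id}\otimes c_{1,m})(c\otimes\mathrm{id})$, $c_{n+1,m}=(c_{n,m}\otimes\mathrm{id})(\mathrm{id}\otimes c_{1,m})$), the comultiplication $\Delta_c$ that is an algebra homomorphism to $T(V)\otimes T(V)$ with multiplication $(m\otimes m)(\mathrm{id}\otimes\hat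 c\otimes\mathrm{id})$ and satisfies $\Delta_c(v)=v\otimes1+1\otimes v$ for $v\in V$, and the counit $\varepsilon$ that is an algebra homomorphism vanishing on $V$. A braided biideal of $R=T(V,c)$ is a two-sided ideal $I$ with $\Delta_c(I)\subset R\otimes I+I\otimes R$, $\varepsilon(I)=0$ and $\hat c(R\otimes I+I\otimes R)=R\otimes I+I\otimes R$. Let $\tau$ denote the flip. Let $T(V,\tau c\tau)^{op,cop}$ be $T(V,\tau c\tau)$ with its multiplication $m$, comultiplication $\Delta$ and braiding $\hat d$ replaced by $m\tau$, $\tau\Delta$ and $\tau\hat d\tau$. Let $\varphi:T(V,c)\to T(V,\tau c\tau)^{op,cop}$ be the algebra homomorphism that is the identity on $V$. Identify words in $X$ with the corresponding products in $T(V)$. Words are ordered lexicographically, a proper beginning of a word being smaller than the word. A word is Lyndon if it is nonempty and lexicographically smaller than each of its proper nonempty endings. Write $u\succ v$ if $u$ is shorter than $v$, or if $u,v$ have the same length and $u$ is lexicographically larger than $v$. For a word $u$ let $k\mathbb X_{\succ u}$ be the span of all words $w\succ u$. For a subspace $J\subset T(V)$ let $$S_J=\{u : u \text{ is a Lyndon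 word and } u\notin k\mathbb X_{\succ u}+J\},\qquad h_J(u)=\min\{t\ge1 : u^t\in k\mathbb X_{\succ u^t}+J\}\in\mathbb N\cup\{\infty\}$$ (with $\min\emptyset=\infty$), where $S_J$ is ordered lexicographically. For a totally ordered subset $(S,<)$ of an algebra and $h:S\to\mathbb N\cup\{\infty\}$ the PBW set $B(S,<,h)$ consists of all products $s_1^{e_1}\cdots s_t^{e_t}$ with $t\ge0$, $s_1>\dots>s_t$ in $S$ and $0<e_i<h(s_i)$; the data $(S,<,h)$ form a PBW basis of the algebra if this set is a vector space basis of it. **Theorem.** The map $\varphi$ is an isomorphism of braided bialgebras (i.e. bijective and compatible with units, multiplications, comultiplications, counits and braidings), and $\varphi(v_1\cdots v_n)=v_n\cdots v_1$ for $v_1,\dots,v_n\in V$. Let $I\subsetneq T(V,c)$ be a braided biideal, and let $\pi:T(V,c)\to T(V,c)/I$ be the quotient map. Put $S=\varphi^{-1}(S_{\varphi(I)})$, with the total order given by $s<t$ if and only if $\varphi(t)$ is lexicographically smaller than $\varphi(s)$, and $h=h_{\varphi(I)}\circ\varphi$ on $S$. Then $\pi$ maps $B(S,<,h)$ injectively onto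 a basis of $T(V,c)/I$. In particular $T(V,c)/I$ has a PBW basis, generated by $\pi(S)$ with the order and the heights carried over from $S$ along the bijection $\pi|_S:S\to\pi(S)$. -/

import Mathlib

open scoped TensorProduct

namespace BraidedPBW

noncomputable section

/-! ## Braided vector spaces -/

section Braided

variable {k V ι : Type*} [Field k] [AddCommGroup V] [Module k V]

/-- The braid equation `(c ⊗ id)(id ⊗ c)(c ⊗ id) = (id ⊗ c)(c ⊗ id)(id ⊗ c)` on `V ⊗ V ⊗ V`.
A braided vector space is a space `V` with an automorphism `c` of `V ⊗ V` satisfying it. -/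
def BraidEquation (c : V ⊗[k] V ≃ₗ[k] V ⊗[k] V) : Prop :=
  let c₁₂ : (V ⊗[k] V) ⊗[k] V →ₗ[k] (V ⊗[k] V) ⊗[k] V := c.toLinearMap.rTensor V
  let c₂₃ : (V ⊗[k] V) ⊗[k] V →ₗ[k] (V ⊗[k] V) ⊗[k] V :=
    (TensorProduct.assoc k V V V).symm.toLinearMap ∘ₗ c.toLinearMap.lTensor V ∘ₗ
      (TensorProduct.assoc k V V V).toLinearMap
  c₁₂ ∘ₗ c₂₃ ∘ₗ c₁₂ = c₂₃ ∘ₗ c₁₂ ∘ₗ c₂₃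

/-- `τ c τ`, where `τ` is the flip of `V ⊗ V`. -/
def flipConj (c : V ⊗[k] V ≃ₗ[k] V ⊗[k] V) : V ⊗[k] V ≃ₗ[k] V ⊗[k] V :=
  TensorProduct.comm k V V ≪≫ₗ c ≪≫ₗ TensorProduct.comm k V V

/-- `c` is right triangular with respect to the totally ordered basis `b`:
`c (x ⊗ y) = β x y • (y ⊗ x) + ∑_{z > x} w x y z ⊗ z` for all basis vectors `x`, `y`. -/
def IsRightTriangular [Fintype ι] [LinearOrder ι] (b : Module.Basis ι k V)
    (c : V ⊗[k] V ≃ₗ[k] V ⊗[k] V) : Prop :=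
  ∃ (β : ι → ι → k) (w : ι → ι → ι → V), ∀ x y : ι,
    c (b x ⊗ₜ[k] b y) = β x y • (b y ⊗ₜ[k] b x) +
      ∑ z ∈ Finset.univ.filter (fun z => x < z), w x y z ⊗ₜ[k] b z

end Braided

/-! ## The braided tensor bialgebra `T(V,c)` -/

section TensorBialgebra

variable {k V : Type*} [Field k] [AddCommGroup V] [Module k V]

/-- `t ⊗ (y ⊗ v) ↦ t y ⊗ v`. -/
def absorbLeft : TensorAlgebra k V ⊗[k] (V ⊗[k] V) →ₗ[k] TensorAlgebra k V ⊗[k] V :=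
  (LinearMap.mul' k (TensorAlgebra k V) ∘ₗ
      (TensorAlgebra.ι k).lTensor (TensorAlgebra k V)).rTensor V ∘ₗ
    (TensorProduct.assoc k (TensorAlgebra k V) V V).symm.toLinearMap

/-- `(t ⊗ v) ⊗ s ↦ t ⊗ v s`. -/
def absorbRight : (TensorAlgebra k V ⊗[k] V) ⊗[k] TensorAlgebra k V →ₗ[k]
    TensorAlgebra k V ⊗[k] TensorAlgebra k V :=
  (LinearMap.mul' k (TensorAlgebra k V) ∘ₗ
      (TensorAlgebra.ι k).rTensor (TensorAlgebra k V)).lTensor (TensorAlgebra k V) ∘ₗ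
    (TensorProduct.assoc k (TensorAlgebra k V) V (TensorAlgebra k V)).toLinearMap

/-- For a letter `y`, the operator `t ⊗ v ↦ (t ⊗ 1) · c (v ⊗ y)` on `T(V) ⊗ V`. -/
def passLetter (c : V ⊗[k] V ≃ₗ[k] V ⊗[k] V) :
    V →ₗ[k] Module.End k (TensorAlgebra k V ⊗[k] V) :=
  (LinearMap.compRight k absorbLeft) ∘ₗ LinearMap.lTensorHom (TensorAlgebra k V) ∘ₗ
    (LinearMap.compRight k c.toLinearMap) ∘ₗ (TensorProduct.mk k V V).flip

/-- The maps `c_{1,m} : V ⊗ V^{⊗ m} → V^{⊗ m} ⊗ V`, assembled over all `m`: the letter `v` is moved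
past the letters of a word one after the other, beginning with the leftmost one. -/
def braidOne (c : V ⊗[k] V ≃ₗ[k] V ⊗[k] V) :
    V →ₗ[k] TensorAlgebra k V →ₗ[k] TensorAlgebra k V ⊗[k] V :=
  (LinearMap.lcomp k (TensorAlgebra k V ⊗[k] V) (TensorProduct.mk k (TensorAlgebra k V) V 1) ∘ₗ
    (MulOpposite.opLinearEquiv k).symm.toLinearMap ∘ₗ
    (TensorAlgebra.lift k ((MulOpposite.opLinearEquiv k).toLinearMap ∘ₗ
      passLetter c)).toLinearMap).flip

/-- For a letter `v`, the operator `y ⊗ s ↦ c (v ⊗ y) · (1 ⊗ s)` on `T(V) ⊗ T(V)`. -/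
def braidOneOp (c : V ⊗[k] V ≃ₗ[k] V ⊗[k] V) :
    V →ₗ[k] Module.End k (TensorAlgebra k V ⊗[k] TensorAlgebra k V) :=
  (LinearMap.compRight k absorbRight) ∘ₗ LinearMap.rTensorHom (TensorAlgebra k V) ∘ₗ braidOne c

/-- The braiding of `T(V)` induced by `c`, i.e. the maps
`c_{n,m} : V^{⊗ n} ⊗ V^{⊗ m} → V^{⊗ m} ⊗ V^{⊗ n}` assembled over all `n` and `m`: the letters of the
first word are moved past the second word one after the other, beginning with the rightmost one.
The defining recursions are recorded in the lemmas below. -/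
def braiding (c : V ⊗[k] V ≃ₗ[k] V ⊗[k] V) :
    TensorAlgebra k V ⊗[k] TensorAlgebra k V →ₗ[k] TensorAlgebra k V ⊗[k] TensorAlgebra k V :=
  TensorProduct.lift
    (LinearMap.lcomp k (TensorAlgebra k V ⊗[k] TensorAlgebra k V)
        ((TensorProduct.mk k (TensorAlgebra k V) (TensorAlgebra k V)).flip 1) ∘ₗ
      (TensorAlgebra.lift k (braidOneOp c)).toLinearMap)

/-- The multiplication `(m ⊗ m)(id ⊗ c ⊗ id)` on `T(V) ⊗ T(V)`. -/
def braidedMul (c : V ⊗[k] V ≃ₗ[k] V ⊗[k] V) :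
    (TensorAlgebra k V ⊗[k] TensorAlgebra k V) ⊗[k] (TensorAlgebra k V ⊗[k] TensorAlgebra k V)
      →ₗ[k] TensorAlgebra k V ⊗[k] TensorAlgebra k V :=
  let T := TensorAlgebra k V
  TensorProduct.map (LinearMap.mul' k T) (LinearMap.mul' k T) ∘ₗ
    (TensorProduct.assoc k T T (T ⊗[k] T)).symm.toLinearMap ∘ₗ
    ((TensorProduct.assoc k T T T).toLinearMap ∘ₗ (braiding c).rTensor T ∘ₗ
      (TensorProduct.assoc k T T T).symm.toLinearMap).lTensor T ∘ₗ
    (TensorProduct.assoc k T T (T ⊗[k] T)).toLinearMap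

/-- Left multiplication by `v ⊗ 1 + 1 ⊗ v` with respect to `braidedMul c`. -/
def primitiveMul (c : V ⊗[k] V ≃ₗ[k] V ⊗[k] V) :
    V →ₗ[k] Module.End k (TensorAlgebra k V ⊗[k] TensorAlgebra k V) :=
  TensorProduct.curry (braidedMul c) ∘ₗ
    ((TensorProduct.mk k (TensorAlgebra k V) (TensorAlgebra k V)).flip 1 ∘ₗ TensorAlgebra.ι k +
      TensorProduct.mk k (TensorAlgebra k V) (TensorAlgebra k V) 1 ∘ₗ TensorAlgebra.ι k)

/-- The comultiplication of `T(V,c)`: the algebra homomorphism from `T(V)` to `T(V) ⊗ T(V)` with the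
multiplication `braidedMul c` that sends `v ∈ V` to `v ⊗ 1 + 1 ⊗ v`, so that
`Δ (v₁ ⋯ vₙ) = Δ v₁ · (Δ v₂ · (⋯ (Δ vₙ · (1 ⊗ 1))))`. -/
def comul (c : V ⊗[k] V ≃ₗ[k] V ⊗[k] V) :
    TensorAlgebra k V →ₗ[k] TensorAlgebra k V ⊗[k] TensorAlgebra k V :=
  LinearMap.applyₗ ((1 : TensorAlgebra k V) ⊗ₜ[k] (1 : TensorAlgebra k V)) ∘ₗ
    (TensorAlgebra.lift k (primitiveMul c)).toLinearMap

/-- The counit of `T(V)`: the algebra homomorphism that vanishes on `V`. -/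
def counit : TensorAlgebra k V →ₐ[k] k :=
  TensorAlgebra.algebraMapInv

/-- The subspace `R ⊗ I + I ⊗ R` of `R ⊗ R`, for `R = T(V)`. -/
def sumTensor (I : Submodule k (TensorAlgebra k V)) :
    Submodule k (TensorAlgebra k V ⊗[k] TensorAlgebra k V) :=
  LinearMap.range (I.subtype.lTensor (TensorAlgebra k V)) ⊔
    LinearMap.range (I.subtype.rTensor (TensorAlgebra k V))

/-- A two-sided ideal `I` of `R = T(V,c)` is a braided biideal if it is a coideal and
`c (R ⊗ I + I ⊗ R) = R ⊗ I + I ⊗ R`. -/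
structure IsBraidedBiideal (c : V ⊗[k] V ≃ₗ[k] V ⊗[k] V) (I : Ideal (TensorAlgebra k V))
    [I.IsTwoSided] : Prop where
  comul_mem : ∀ x ∈ I, comul c x ∈ sumTensor (I.restrictScalars k)
  counit_eq_zero : ∀ x ∈ I, counit (k := k) (V := V) x = 0
  map_braiding : (sumTensor (I.restrictScalars k)).map (braiding c) =
    sumTensor (I.restrictScalars k)

/-- The map `φ : T(V) → T(V)`, the algebra homomorphism to the opposite algebra that is the identity
on `V`. -/
def reversal : TensorAlgebra k V →ₗ[k] TensorAlgebra k V :=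
  (MulOpposite.opLinearEquiv k).symm.toLinearMap ∘ₗ
    (TensorAlgebra.lift k
      ((MulOpposite.opLinearEquiv k).toLinearMap ∘ₗ TensorAlgebra.ι k)).toLinearMap

/-- `f` is an isomorphism of braided bialgebras from `T(V,c)` to `T(V,τcτ)^{op,cop}`, the latter
having multiplication `m τ`, comultiplication `τ Δ`, the unit and counit of `T(V,τcτ)`, and
braiding `τ ĉ τ`, where `m`, `Δ`, `ĉ` are those of `T(V,τcτ)`. -/
structure IsIsoToOpCop (c : V ⊗[k] V ≃ₗ[k] V ⊗[k] V)
    (f : TensorAlgebra k V →ₗ[k] TensorAlgebra k V) : Prop where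
  bijective : Function.Bijective f
  map_one : f 1 = 1
  map_mul : ∀ x y, f (x * y) = f y * f x
  map_comul : ∀ x, TensorProduct.map f f (comul c x) =
    TensorProduct.comm k (TensorAlgebra k V) (TensorAlgebra k V) (comul (flipConj c) (f x))
  map_counit : ∀ x, counit (k := k) (V := V) (f x) = counit (k := k) (V := V) x
  map_braiding : ∀ z, TensorProduct.map f f (braiding c z) =
    TensorProduct.comm k (TensorAlgebra k V) (TensorAlgebra k V)
      (braiding (flipConj c)
        (TensorProduct.comm k (TensorAlgebra k V) (TensorAlgebra k V)
          (TensorProduct.map f f z)))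

/-! ### The recursions for the braiding and the comultiplication -/

theorem passLetter_tmul (c : V ⊗[k] V ≃ₗ[k] V ⊗[k] V) (t : TensorAlgebra k V) (v y : V) :
    passLetter c y (t ⊗ₜ[k] v) = absorbLeft (t ⊗ₜ[k] c (v ⊗ₜ[k] y)) := rfl

theorem braidOneOp_tmul (c : V ⊗[k] V ≃ₗ[k] V ⊗[k] V) (v : V) (y s : TensorAlgebra k V) :
    braidOneOp c v (y ⊗ₜ[k] s) = absorbRight (braidOne c v y ⊗ₜ[k] s) := rfl

/-- `c_{1,0} = id`. -/
theorem braidOne_one (c : V ⊗[k] V ≃ₗ[k] V ⊗[k] V) (v : V) :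
    braidOne c v 1 = 1 ⊗ₜ[k] v := by
  simp [braidOne]

theorem absorbLeft_tmul (t : TensorAlgebra k V) (y v : V) :
    absorbLeft (t ⊗ₜ[k] (y ⊗ₜ[k] v)) = (t * TensorAlgebra.ι k y) ⊗ₜ[k] v := by
  simp [absorbLeft]

theorem absorbRight_tmul (t s : TensorAlgebra k V) (v : V) :
    absorbRight ((t ⊗ₜ[k] v) ⊗ₜ[k] s) = t ⊗ₜ[k] (TensorAlgebra.ι k v * s) := by
  simp [absorbRight]

/-- The recursion for `c_{1,m}`, in the form `c_{1,m+1} = (id ⊗ c)(c_{1,m} ⊗ id)`. -/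
theorem braidOne_mul_ι (c : V ⊗[k] V ≃ₗ[k] V ⊗[k] V) (v y : V) (x : TensorAlgebra k V) :
    braidOne c v (x * TensorAlgebra.ι k y) = passLetter c y (braidOne c v x) := by
  simp [braidOne]

theorem braidOne_ι (c : V ⊗[k] V ≃ₗ[k] V ⊗[k] V) (v y : V) :
    braidOne c v (TensorAlgebra.ι k y) =
      (TensorAlgebra.ι k).rTensor V (c (v ⊗ₜ[k] y)) := by
  have h := braidOne_mul_ι c v y 1
  rw [one_mul, braidOne_one, passLetter_tmul] at h
  rw [h]
  induction c (v ⊗ₜ[k] y) using TensorProduct.induction_on with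
  | zero => simp
  | tmul a b => simp [absorbLeft_tmul]
  | add a b ha hb => simp only [TensorProduct.tmul_add, map_add, ha, hb]

/-- `c_{0,m} = id`. -/
theorem braiding_one_tmul (c : V ⊗[k] V ≃ₗ[k] V ⊗[k] V) (y : TensorAlgebra k V) :
    braiding c (1 ⊗ₜ[k] y) = y ⊗ₜ[k] 1 := by
  simp [braiding]

/-- The recursion for `c_{n,m}`, in the form `c_{n+1,m} = (c_{1,m} ⊗ id)(id ⊗ c_{n,m})`. -/
theorem braiding_ι_mul_tmul (c : V ⊗[k] V ≃ₗ[k] V ⊗[k] V) (v : V) (x y : TensorAlgebra k V) :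
    braiding c ((TensorAlgebra.ι k v * x) ⊗ₜ[k] y) = braidOneOp c v (braiding c (x ⊗ₜ[k] y)) := by
  simp [braiding]

/-- On `V ⊗ T(V)` the braiding is given by the maps `c_{1,m}`. -/
theorem braiding_ι_tmul (c : V ⊗[k] V ≃ₗ[k] V ⊗[k] V) (v : V) (y : TensorAlgebra k V) :
    braiding c (TensorAlgebra.ι k v ⊗ₜ[k] y) =
      (TensorAlgebra.ι k).lTensor (TensorAlgebra k V) (braidOne c v y) := by
  have h := braiding_ι_mul_tmul c v 1 y
  rw [mul_one, braiding_one_tmul, braidOneOp_tmul] at h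
  rw [h]
  induction braidOne c v y using TensorProduct.induction_on with
  | zero => simp
  | tmul a b => simp [absorbRight_tmul]
  | add a b ha hb => simp only [TensorProduct.add_tmul, map_add, ha, hb]

theorem braidedMul_tmul (c : V ⊗[k] V ≃ₗ[k] V ⊗[k] V) (x y z w : TensorAlgebra k V) :
    braidedMul c ((x ⊗ₜ[k] y) ⊗ₜ[k] (z ⊗ₜ[k] w)) =
      TensorProduct.map (LinearMap.mulLeft k x) (LinearMap.mulRight k w)
        (braiding c (y ⊗ₜ[k] z)) := by
  simp only [braidedMul, LinearMap.comp_apply, LinearEquiv.coe_coe, TensorProduct.assoc_tmul,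
    LinearMap.lTensor_tmul, TensorProduct.assoc_symm_tmul, LinearMap.rTensor_tmul]
  induction braiding c (y ⊗ₜ[k] z) using TensorProduct.induction_on with
  | zero => simp
  | tmul a b => simp
  | add a b ha hb => simp only [TensorProduct.tmul_add, TensorProduct.add_tmul, map_add, ha, hb]

theorem comul_one (c : V ⊗[k] V ≃ₗ[k] V ⊗[k] V) : comul c 1 = 1 ⊗ₜ[k] 1 := by
  simp [comul]

theorem comul_ι_mul (c : V ⊗[k] V ≃ₗ[k] V ⊗[k] V) (v : V) (x : TensorAlgebra k V) :
    comul c (TensorAlgebra.ι k v * x) =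
      braidedMul c ((TensorAlgebra.ι k v ⊗ₜ[k] 1 + 1 ⊗ₜ[k] TensorAlgebra.ι k v) ⊗ₜ[k]
        comul c x) := by
  simp [comul, primitiveMul, TensorProduct.add_tmul]

theorem comul_ι (c : V ⊗[k] V ≃ₗ[k] V ⊗[k] V) (v : V) :
    comul c (TensorAlgebra.ι k v) =
      TensorAlgebra.ι k v ⊗ₜ[k] 1 + 1 ⊗ₜ[k] TensorAlgebra.ι k v := by
  have h := comul_ι_mul c v 1
  rw [mul_one, comul_one, TensorProduct.add_tmul, map_add, braidedMul_tmul, braidedMul_tmul,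
    braiding_one_tmul, braiding_ι_tmul, braidOne_one] at h
  simpa using h

end TensorBialgebra

/-! ## Words -/

section Words

variable {ι : Type*} [LinearOrder ι]

/-- The lexicographical order on words (a proper beginning of a word is smaller than the word). -/
def LexLT (u v : FreeMonoid ι) : Prop :=
  FreeMonoid.toList u < FreeMonoid.toList v

/-- The word `u` is larger than the word `v` in the standard order: it is shorter than `v`, or it
has the same length and is lexicographically larger. -/
def StdGT (u v : FreeMonoid ι) : Prop :=
  u.length < v.length ∨ (u.length = v.length ∧ LexLT v u)

/-- Lyndon words: nonempty words that are smaller than each of their proper endings. -/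
def IsLyndon (u : FreeMonoid ι) : Prop :=
  u ≠ 1 ∧ ∀ v w : FreeMonoid ι, v ≠ 1 → w ≠ 1 → u = v * w → LexLT u w

variable {k V : Type*} [Field k] [AddCommGroup V] [Module k V]

/-- The basis element of `T(V)` at a word is the product of the letters of the word. -/
theorem tensorAlgebra_basis_eq_prod (b : Module.Basis ι k V) (u : FreeMonoid ι) :
    b.tensorAlgebra u = (u.toList.map (fun i => TensorAlgebra.ι k (b i))).prod := by
  have h : b.tensorAlgebra u = (TensorAlgebra.equivFreeAlgebra b).symm
      (FreeAlgebra.equivMonoidAlgebraFreeMonoid.symm (MonoidAlgebra.of k _ u)) := rfl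
  rw [h]
  clear h
  induction u using FreeMonoid.inductionOn' with
  | one => rw [map_one, map_one, map_one]; rfl
  | of_mul x xs ih =>
    rw [map_mul, map_mul, map_mul, ih]
    simp [FreeAlgebra.equivMonoidAlgebraFreeMonoid]

/-- The span `k𝕏_{≻u}` of all words larger than `u` in the standard order. The word
`x₁ ⋯ xₙ` is identified with the product `b x₁ ⋯ b xₙ` in `T(V)`, which is `b.tensorAlgebra` of
it. -/
def spanAbove (b : Module.Basis ι k V) (u : FreeMonoid ι) : Submodule k (TensorAlgebra k V) :=
  Submodule.span k (b.tensorAlgebra '' {w | StdGT w u})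

/-- The set `S_J` of all Lyndon words `u` with `u ∉ k𝕏_{≻u} + J`, as a subset of `T(V)`. -/
def hardWords (b : Module.Basis ι k V) (J : Submodule k (TensorAlgebra k V)) :
    Set (TensorAlgebra k V) :=
  b.tensorAlgebra '' {u | IsLyndon u ∧ b.tensorAlgebra u ∉ spanAbove b u ⊔ J}

/-- The height of a word `u`: the least positive integer `t` with `u ^ t ∈ k𝕏_{≻u^t} + J`, and `∞`
if there is none. -/
def wordHeight (b : Module.Basis ι k V) (J : Submodule k (TensorAlgebra k V))
    (u : FreeMonoid ι) : ℕ∞ :=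
  sInf {t : ℕ∞ | ∃ n : ℕ, 1 ≤ n ∧ t = n ∧
    b.tensorAlgebra (u ^ n) ∈ spanAbove b (u ^ n) ⊔ J}

/-- The height function `h_J` on words, the words being regarded as elements of `T(V)`. (Distinct
words are distinct elements, so the infimum is over a single word if `a` is a word.) -/
def height (b : Module.Basis ι k V) (J : Submodule k (TensorAlgebra k V))
    (a : TensorAlgebra k V) : ℕ∞ :=
  ⨅ (u : FreeMonoid ι) (_ : b.tensorAlgebra u = a), wordHeight b J u

/-- The lexicographical order on words, the words being regarded as elements of `T(V)`. -/
def ElemLexLT (b : Module.Basis ι k V) (x y : TensorAlgebra k V) : Prop :=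
  ∃ u v : FreeMonoid ι, b.tensorAlgebra u = x ∧ b.tensorAlgebra v = y ∧ LexLT u v

end Words

/-! ## PBW bases -/

section PBW

variable {A : Type*} [Ring A]

/-- The PBW set generated by `P`, `(S,<)` and `h`: all products `s₁^{e₁} ⋯ s_t^{e_t} p` with
`t ≥ 0`, `s₁ > ⋯ > s_t` in `S`, `0 < e_i < h (s_i)` and `p ∈ P`. -/
def pbwSet (P S : Set A) (lt : S → S → Prop) (h : S → ℕ∞) : Set A :=
  {a | ∃ (l : List (S × ℕ)) (p : A), p ∈ P ∧
    l.Pairwise (fun x y => lt y.1 x.1) ∧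
    (∀ x ∈ l, 0 < x.2 ∧ (x.2 : ℕ∞) < h x.1) ∧
    a = (l.map (fun x => (x.1 : A) ^ x.2)).prod * p}

/-- `(P,S,<,h)` is a PBW basis of the algebra `A`: `<` is a total order on `S`, and the PBW set is a
basis of `A`. -/
def IsPBWBasis (k : Type*) [Field k] [Algebra k A] (P S : Set A) (lt : S → S → Prop)
    (h : S → ℕ∞) : Prop :=
  IsStrictTotalOrder S lt ∧ LinearIndepOn k id (pbwSet P S lt h) ∧
    Submodule.span k (pbwSet P S lt h) = ⊤

end PBW

end

end BraidedPBW

/-! Word reversal φ replaces `c` by `d = τcτ`, which is left triangular: `d` moves a word past a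
word `z` with a nonzero leading coefficient, and every other term has a left word of the same length
as `z` that exceeds it at some letter (`IsRightTriangular.exists_isLeftTriangular`,
`IsLeftTriangular.braiding_sub_mem`). Since φ carries Δ_c to τΔ_d (`map_reversal_comul`), `J = φ(I)`
is a proper ideal and a coideal for Δ_d, and it suffices to work modulo `J`.

Call a word normal if modulo `J` it is not a combination of words that are larger in the standard
order. Over a finite alphabet only finitely many words are larger than a given one, so the normal
words form a basis modulo `J` (`wordElem_mem_normal`, `normalWords_independent`). It remains to
recognize them as the reversed PBW products: a word is normal if and only if every power in its
factorization v_t^{e_t}⋯v_1^{e_1} into Lyndon words v_1 < ⋯ < v_t is normal. Factors of normal words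
are normal because `J` is an ideal. The converse, `IsNormalList.isNormalWord`, is the heart of the
proof.

For the converse, each Lyndon word w gets an iterated braided commutator g_w with leading word w,
such that Δ(g_w) is 1 ⊗ g_w + w ⊗ 1 plus terms whose left words exceed w at some letter
(`isLyndonElement_append`). If x is a product of elements g_w with w > v, then Δ(x g_v^r) contains
v^r ⊗ x with nonzero coefficient; all other left words exceed a power of v or are v^j with j < r
(`comul_mul_pow_sub_mem`). When v^r is normal, some linear form f kills `J` and all words larger
than v^r, but not v^r. The map (f ⊗ id)Δ preserves `J`, and up to lower degree it strips g_v^r from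
the products ending in it. Applied to a relation in which v is minimal and then r maximal, it leaves
a relation of smaller degree. Hence the products given by normal powers are independent modulo `J`
and lower degree (`lyndonProd_independent`). A list of normal powers with a non-normal word would
produce a forbidden relation among them. -/

namespace BraidedPBW

/-! ### Lyndon words, their factorization, and comparison with powers -/

section WordCombinatorics

set_option linter.unusedSectionVars false

variable {ι : Type*} [LinearOrder ι]

/-- `Diverges u w`: after a common beginning, `w` continues with a larger letter than `u`. -/
inductive Diverges : List ι → List ι → Prop
  | rel {x y : ι} {s t : List ι} (h : x < y) : Diverges (x :: s) (y :: t)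
  | cons {x : ι} {s t : List ι} (h : Diverges s t) : Diverges (x :: s) (x :: t)

theorem Diverges.append {u w : List ι} (h : Diverges u w) (s t : List ι) :
    Diverges (u ++ s) (w ++ t) := by
  induction h with
  | rel h => exact .rel h
  | cons _ ih => exact .cons ih

theorem Diverges.append_left {u w : List ι} (h : Diverges u w) (t : List ι) :
    Diverges u (w ++ t) := by
  simpa using h.append [] t

theorem Diverges.prepend {u w : List ι} (h : Diverges u w) (p : List ι) :
    Diverges (p ++ u) (p ++ w) := by
  induction p with
  | nil => exact h
  | cons x p ih => exact .cons ih

theorem Diverges.trans {u v w : List ι} (h : Diverges u v) (h' : Diverges v w) :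
    Diverges u w := by
  induction h generalizing w with
  | rel h =>
    cases h' with
    | rel h' => exact .rel (h.trans h')
    | cons h' => exact .rel h
  | cons h ih =>
    cases h' with
    | rel h' => exact .rel h'
    | cons h' => exact .cons (ih h')

/-- The deciding letter lies within `w`, hence within `u`, so the tail `s` plays no role. -/
theorem Diverges.of_append {u s w : List ι} (h : Diverges (u ++ s) w)
    (hl : w.length ≤ u.length) : Diverges u w := by
  induction u generalizing w with
  | nil =>
    obtain rfl : w = [] := List.eq_nil_of_length_eq_zero (by simpa using hl)
    cases h
  | cons x u ih =>
    cases h with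
    | rel h => exact .rel h
    | cons h => exact .cons (ih h (by simpa using hl))

theorem Diverges.lt {u w : List ι} (h : Diverges u w) : u < w := by
  induction h with
  | rel h => exact List.cons_lt_cons_iff.2 (.inl h)
  | cons _ ih => exact List.cons_lt_cons_iff.2 (.inr ⟨rfl, ih⟩)

theorem lt_append {u t : List ι} (ht : t ≠ []) : u < u ++ t := by
  induction u with
  | nil =>
    cases t with
    | nil => exact absurd rfl ht
    | cons x t => exact List.nil_lt_cons x t
  | cons x u ih => exact List.cons_lt_cons_iff.2 (.inr ⟨rfl, ih⟩)

theorem le_append (u t : List ι) : u ≤ u ++ t := by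
  by_cases ht : t = []
  · simp [ht]
  · exact (lt_append ht).le

theorem lt_iff_prefix_or_diverges {u w : List ι} :
    u < w ↔ (∃ t, t ≠ [] ∧ w = u ++ t) ∨ Diverges u w := by
  constructor
  · intro h
    induction u generalizing w with
    | nil =>
      refine .inl ⟨w, ?_, rfl⟩
      rintro rfl
      exact lt_irrefl _ h
    | cons x u ih =>
      cases w with
      | nil => exact absurd h (List.not_lt_nil _)
      | cons y w =>
        rcases List.cons_lt_cons_iff.1 h with h | ⟨rfl, h'⟩
        · exact .inr (.rel h)
        · rcases ih h' with ⟨t, ht, rfl⟩ | h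
          · exact .inl ⟨t, ht, rfl⟩
          · exact .inr (.cons h)
  · rintro (⟨t, ht, rfl⟩ | h)
    · exact lt_append ht
    · exact h.lt

/-- A larger word that is not longer cannot be a continuation, so a letter decides. Unlike `<`, this
comparison survives appending arbitrary tails on both sides. -/
theorem diverges_of_lt {u w : List ι} (h : u < w) (hl : w.length ≤ u.length) :
    Diverges u w := by
  rcases lt_iff_prefix_or_diverges.1 h with ⟨t, ht, rfl⟩ | h
  · rw [List.length_append] at hl
    exact absurd (List.eq_nil_of_length_eq_zero (by omega)) ht
  · exact h

/-- The power `v ^ n` of a word. -/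
def rep (v : List ι) (n : ℕ) : List ι := (List.replicate n v).flatten

@[simp] theorem rep_zero (v : List ι) : rep v 0 = [] := rfl

theorem rep_succ (v : List ι) (n : ℕ) : rep v (n + 1) = v ++ rep v n := rfl

theorem rep_add (v : List ι) (m n : ℕ) : rep v (m + n) = rep v m ++ rep v n := by
  rw [rep, rep, rep, ← List.flatten_append, List.replicate_append_replicate]

@[simp] theorem rep_one (v : List ι) : rep v 1 = v := by simp [rep]

theorem rep_succ' (v : List ι) (n : ℕ) : rep v (n + 1) = rep v n ++ v := by
  rw [rep_add, rep_one]

@[simp] theorem length_rep (v : List ι) (n : ℕ) : (rep v n).length = n * v.length := by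
  simp [rep]

/-- Lyndon words, as lists of letters. -/
def Lyndon (w : List ι) : Prop :=
  w ≠ [] ∧ ∀ u v : List ι, u ≠ [] → v ≠ [] → w = u ++ v → w < v

theorem lyndon_singleton (x : ι) : Lyndon [x] := by
  refine ⟨by simp, fun u v hu hv h => ?_⟩
  have := congrArg List.length h
  have := List.length_pos_iff.2 hu
  have := List.length_pos_iff.2 hv
  simp at *
  omega

/-- The delicate case is `b = a ++ t`: then `b < t` with `t` shorter, so a letter decides, and
prepending `a` to both sides gives the claim. -/
theorem Lyndon.append_lt {a b : List ι} (hb : Lyndon b) (ha : a ≠ []) (h : a < b) :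
    a ++ b < b := by
  rcases lt_iff_prefix_or_diverges.1 h with ⟨t, ht, e⟩ | h
  · have := hb.2 a t ha ht e
    conv_rhs => rw [e]
    have h2 : Diverges b t := diverges_of_lt this (by rw [e]; simp)
    exact (h2.prepend a).lt
  · simpa using (h.append b []).lt

/-- A proper ending is either an ending of `b`, thus at least `b` and above `a ++ b`, or a proper
ending of `a` followed by `b`, where a letter already decides. -/
theorem Lyndon.append {a b : List ι} (ha : Lyndon a) (hb : Lyndon b) (h : a < b) :
    Lyndon (a ++ b) := by
  refine ⟨by simp [ha.1], fun u v hu hv e => ?_⟩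
  have hab := hb.append_lt ha.1 h
  rcases List.append_eq_append_iff.1 e with ⟨s, rfl, rfl⟩ | ⟨s, rfl, rfl⟩
  · by_cases hs : s = []
    · subst hs; simpa using hab
    · exact hab.trans (hb.2 s v hs hv rfl)
  · by_cases hs : s = []
    · subst hs; simpa using hab
    · have := ha.2 u s hu hs rfl
      have h2 := diverges_of_lt this (by simp)
      exact (h2.append b b).lt

/-- The word `v₁ ^ e₁` preceded by `v₂ ^ e₂` and so on. -/
def powerWord : List (List ι × ℕ) → List ι
  | [] => []
  | x :: q => powerWord q ++ rep x.1 x.2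

/-- Strictly increasing lists of Lyndon words, with positive exponents. -/
def LyndonList (q : List (List ι × ℕ)) : Prop :=
  q.Pairwise (fun x y => x.1 < y.1) ∧ ∀ x ∈ q, Lyndon x.1 ∧ 0 < x.2

theorem LyndonList.tail {x : List ι × ℕ} {q : List (List ι × ℕ)} (h : LyndonList (x :: q)) :
    LyndonList q :=
  ⟨(List.pairwise_cons.1 h.1).2, fun y hy => h.2 y (List.mem_cons_of_mem _ hy)⟩

theorem LyndonList.le_powerWord {x : List ι × ℕ} {q : List (List ι × ℕ)}
    (h : LyndonList (x :: q)) : x.1 ≤ powerWord (x :: q) := by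
  induction q generalizing x with
  | nil =>
    obtain ⟨n, hn⟩ := Nat.exists_eq_succ_of_ne_zero (h.2 x (by simp)).2.ne'
    simp only [powerWord, List.nil_append, hn, Nat.succ_eq_add_one, rep_succ]
    exact le_append _ _
  | cons y q ih =>
    have h1 : x.1 < y.1 := (List.pairwise_cons.1 h.1).1 y (by simp)
    exact (h1.le.trans (ih h.tail)).trans (le_append _ _)

theorem LyndonList.cons_of_lt {l : List ι} {x : List ι × ℕ} {q : List (List ι × ℕ)}
    (h : LyndonList (x :: q)) (hl : Lyndon l) (hlt : l < x.1) :
    LyndonList ((l, 1) :: x :: q) := by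
  refine ⟨List.pairwise_cons.2 ⟨fun y hy => ?_, h.1⟩, fun y hy => ?_⟩
  · rcases List.mem_cons.1 hy with rfl | hy
    · exact hlt
    · exact hlt.trans ((List.pairwise_cons.1 h.1).1 y hy)
  · rcases List.mem_cons.1 hy with rfl | hy
    · exact ⟨hl, one_pos⟩
    · exact h.2 y hy

theorem LyndonList.set_exponent {v : List ι} {n m : ℕ} {q : List (List ι × ℕ)}
    (h : LyndonList ((v, n) :: q)) (hm : 0 < m) : LyndonList ((v, m) :: q) := by
  refine ⟨List.pairwise_cons.2 ⟨fun y hy => (List.pairwise_cons.1 h.1).1 y hy,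
    (List.pairwise_cons.1 h.1).2⟩, fun y hy => ?_⟩
  rcases List.mem_cons.1 hy with rfl | hy
  · exact ⟨(h.2 (v, n) (by simp)).1, hm⟩
  · exact h.2 y (List.mem_cons_of_mem _ hy)

/-- Compare `l` with the smallest factor `v`, which stands last in the word. A smaller `l` is a new
factor, an equal one raises the exponent, and a larger one merges into the Lyndon word `v ++ l`,
which is then appended to a shorter product. -/
theorem exists_lyndonList_append {q : List (List ι × ℕ)} (hq : LyndonList q) :
    ∀ l : List ι, Lyndon l → ∃ q', LyndonList q' ∧ powerWord q' = powerWord q ++ l := by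
  induction q with
  | nil =>
    intro l hl
    refine ⟨[(l, 1)], ⟨by simp, ?_⟩, by simp [powerWord]⟩
    simp [hl]
  | cons x q ih =>
    obtain ⟨v, n⟩ := x
    have key : ∀ (s : ℕ) (l : List ι), Lyndon l →
        ∃ q', LyndonList q' ∧ powerWord q' = powerWord q ++ rep v s ++ l := by
      intro s
      induction s with
      | zero =>
        intro l hl
        simpa using ih hq.tail l hl
      | succ s ihs =>
        intro l hl
        have hs := hq.set_exponent s.succ_pos
        rcases lt_trichotomy l v with h | rfl | h
        · exact ⟨_, hs.cons_of_lt hl h, by simp [powerWord]⟩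
        · exact ⟨_, hq.set_exponent (s + 1).succ_pos, by simp [powerWord, rep_succ' l (s + 1)]⟩
        · obtain ⟨q', h1, h2⟩ := ihs (v ++ l) ((hq.2 (v, n) (by simp)).1.append hl h)
          exact ⟨q', h1, by simp [h2, rep_succ']⟩
    exact fun l hl => key n l hl

theorem exists_powerWord_eq (w : List ι) : ∃ q, LyndonList q ∧ powerWord q = w := by
  induction w using List.reverseRecOn with
  | nil => exact ⟨[], ⟨by simp, by simp⟩, rfl⟩
  | append_singleton w x ih =>
    obtain ⟨q, hq, rfl⟩ := ih
    exact exists_lyndonList_append hq [x] (lyndon_singleton x)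

/-- Cut off the longest proper Lyndon ending. If the remaining beginning were not Lyndon, the last
factor of its Lyndon factorization would merge with that ending into a longer one. -/
theorem Lyndon.exists_factorization {w : List ι} (hw : Lyndon w) (hl : 2 ≤ w.length) :
    ∃ a b, Lyndon a ∧ Lyndon b ∧ a < b ∧ w = a ++ b := by
  classical
  have hex : ∃ i, 1 ≤ i ∧ Lyndon (w.drop i) := by
    refine ⟨w.length - 1, by omega, ?_⟩
    obtain ⟨x, hx⟩ := List.length_eq_one_iff.1
      (show (w.drop (w.length - 1)).length = 1 by rw [List.length_drop]; omega)
    rw [hx]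
    exact lyndon_singleton x
  -- The least starting position gives the longest ending.
  obtain ⟨i, ⟨hi, hb⟩, hmin⟩ : ∃ i, (1 ≤ i ∧ Lyndon (w.drop i)) ∧
      ∀ j < i, ¬(1 ≤ j ∧ Lyndon (w.drop j)) :=
    ⟨Nat.find hex, Nat.find_spec hex, fun j hj => Nat.find_min hex hj⟩
  have hil : i < w.length := by
    have := List.length_pos_iff.2 hb.1
    simp at this
    omega
  have hw' : w = w.take i ++ w.drop i := (List.take_append_drop i w).symm
  have hta : (w.take i).length = i := by simp; omega
  have ha0 : w.take i ≠ [] := by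
    intro h; rw [h] at hta; simp at hta; omega
  have hwb : w < w.drop i := hw.2 _ _ ha0 hb.1 hw'
  have haw : w.take i < w := by
    conv_rhs => rw [hw']
    exact lt_append hb.1
  refine ⟨w.take i, w.drop i, ?_, hb, haw.trans hwb, hw'⟩
  obtain ⟨q, hq, hqw⟩ := exists_powerWord_eq (w.take i)
  cases q with
  | nil => exact absurd hqw.symm ha0
  | cons x q =>
    obtain ⟨v, n⟩ := x
    have hv := hq.le_powerWord
    rw [hqw] at hv
    obtain ⟨hvL, hn⟩ := hq.2 (v, n) (by simp)
    obtain ⟨m, rfl⟩ := Nat.exists_eq_succ_of_ne_zero hn.ne'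
    have hva : w.take i = (powerWord q ++ rep v m) ++ v := by
      rw [← hqw]; simp [powerWord, rep_succ']
    by_cases h0 : powerWord q ++ rep v m = []
    · rw [hva, h0]; exact hvL
    · exfalso
      have hvb : v < w.drop i := (hv.trans_lt haw).trans hwb
      have hlen := congrArg List.length hva
      rw [hta, List.length_append] at hlen
      have hpos := List.length_pos_iff.2 h0
      have hvpos : 0 < v.length := List.length_pos_iff.2 hvL.1
      refine hmin (powerWord q ++ rep v m).length (by omega) ⟨by omega, ?_⟩
      have : w.drop (powerWord q ++ rep v m).length = v ++ w.drop i := by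
        conv_lhs => rw [hw', hva, List.append_assoc, List.drop_left]
      rw [this]
      exact hvL.append hb hvb

/-- The words that exceed a power of `v` after a common beginning. -/
def PowerDiverges (v z : List ι) : Prop := ∃ n, Diverges (rep v n) z

theorem PowerDiverges.append {v z : List ι} (h : PowerDiverges v z) (t : List ι) :
    PowerDiverges v (z ++ t) :=
  h.imp fun _ h => h.append_left t

theorem PowerDiverges.trans {v z z' : List ι} (h : PowerDiverges v z) (h' : Diverges z z') :
    PowerDiverges v z' :=
  h.imp fun _ h => h.trans h'

theorem PowerDiverges.prepend {v z : List ι} (h : PowerDiverges v z) (j : ℕ) :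
    PowerDiverges v (rep v j ++ z) := by
  obtain ⟨n, h⟩ := h
  exact ⟨j + n, by rw [rep_add]; exact h.prepend _⟩

theorem PowerDiverges.diverges {v z : List ι} (h : PowerDiverges v z) {r : ℕ}
    (hl : z.length ≤ r * v.length) : Diverges (rep v r) z := by
  obtain ⟨n, h⟩ := h
  rcases le_total n r with hn | hn
  · obtain ⟨m, rfl⟩ := Nat.exists_eq_add_of_le hn
    rw [rep_add]
    simpa using h.append (rep v m) []
  · obtain ⟨m, rfl⟩ := Nat.exists_eq_add_of_le hn
    rw [rep_add] at h
    exact h.of_append (by simpa using hl)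

/-- Strip copies of `v` from the front of `w`. Every nonempty ending of `w` exceeds `v`, so the
process never exhausts the word and stops only where a letter decides. -/
theorem Lyndon.powerDiverges {v w : List ι} (hv : Lyndon v) (hw : Lyndon w) (h : v < w) :
    PowerDiverges v w := by
  have key : ∀ (n : ℕ) (t : List ι), t.length ≤ n → t ≠ [] →
      (∀ p s : List ι, s ≠ [] → t = p ++ s → v < s) → PowerDiverges v t := by
    intro n
    induction n with
    | zero => exact fun t hn ht => absurd (List.eq_nil_of_length_eq_zero (by omega)) ht
    | succ n ih =>
      intro t hn ht hs
      rcases lt_iff_prefix_or_diverges.1 (hs [] t ht rfl) with ⟨t', ht', rfl⟩ | h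
      · have hvpos := List.length_pos_iff.2 hv.1
        have := (ih t' (by simp at hn; omega) ht' fun p s h1 h2 =>
          hs (v ++ p) s h1 (by simp [h2])).prepend 1
        simpa using this
      · exact ⟨1, by simpa using h⟩
  refine key w.length w le_rfl hw.1 fun p s h1 h2 => ?_
  by_cases hp : p = []
  · subst hp; rw [← h2.trans (List.nil_append s)]; exact h
  · exact h.trans (hw.2 p s hp h1 h2)

end WordCombinatorics

/-! ### Associativity of the braided product and multiplicativity of Δ -/

noncomputable section BraidedProduct

variable {k V : Type*} [Field k] [AddCommGroup V] [Module k V]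

local notation "T" => TensorAlgebra k V

/-- Left multiplication on the left tensor factor. -/
def mulLeftFst (M : Type*) [AddCommGroup M] [Module k M] (t : T) : T ⊗[k] M →ₗ[k] T ⊗[k] M :=
  (LinearMap.mulLeft k t).rTensor M

/-- Right multiplication on the right tensor factor. -/
def mulRightSnd (s : T) : T ⊗[k] T →ₗ[k] T ⊗[k] T :=
  (LinearMap.mulRight k s).lTensor T

@[simp] theorem mulLeftFst_tmul {M : Type*} [AddCommGroup M] [Module k M] (t x : T) (m : M) :
    mulLeftFst M t (x ⊗ₜ[k] m) = (t * x) ⊗ₜ[k] m := rfl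

@[simp] theorem mulRightSnd_tmul (s x y : T) :
    mulRightSnd s (x ⊗ₜ[k] y) = x ⊗ₜ[k] (y * s) := rfl

theorem mulLeftFst_add {M : Type*} [AddCommGroup M] [Module k M] (t s : T) (X : T ⊗[k] M) :
    mulLeftFst M (t + s) X = mulLeftFst M t X + mulLeftFst M s X := by
  induction X using TensorProduct.induction_on with
  | zero => simp
  | tmul a b => simp [add_mul, TensorProduct.add_tmul]
  | add a b ha hb => simp only [map_add, ha, hb]; abel

theorem mulLeftFst_smul {M : Type*} [AddCommGroup M] [Module k M] (r : k) (t : T)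
    (X : T ⊗[k] M) : mulLeftFst M (r • t) X = r • mulLeftFst M t X := by
  induction X using TensorProduct.induction_on with
  | zero => simp
  | tmul a b => simp [TensorProduct.smul_tmul']
  | add a b ha hb => simp only [map_add, ha, hb, smul_add]

theorem mulLeftFst_mulRightSnd (t s : T) (X : T ⊗[k] T) :
    mulLeftFst _ t (mulRightSnd s X) = mulRightSnd s (mulLeftFst _ t X) := by
  induction X using TensorProduct.induction_on with
  | zero => simp
  | tmul a b => simp
  | add a b ha hb => simp only [map_add, ha, hb]

variable (c : V ⊗[k] V ≃ₗ[k] V ⊗[k] V)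

/-- The operator `z ⊗ w ↦ c (x ⊗ z) · (1 ⊗ w)` on `T(V) ⊗ T(V)`. -/
def braidOp : T →ₐ[k] Module.End k (T ⊗[k] T) :=
  TensorAlgebra.lift k (braidOneOp c)

/-- The operator `t ⊗ v ↦ (t ⊗ 1) · c (v ⊗ z)` on `T(V) ⊗ V`. -/
def passWord (z : T) : T ⊗[k] V →ₗ[k] T ⊗[k] V :=
  (TensorAlgebra.lift k ((MulOpposite.opLinearEquiv k).toLinearMap ∘ₗ passLetter c) z).unop

/-- The operator `y ⊗ x ↦ (y ⊗ 1) · c (x ⊗ z)` on `T(V) ⊗ T(V)`. -/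
def braidOpRight (z : T) : T ⊗[k] T →ₗ[k] T ⊗[k] T :=
  TensorProduct.lift (LinearMap.mk₂ k (fun y x => mulLeftFst _ y (braiding c (x ⊗ₜ[k] z)))
    (fun _ _ _ => mulLeftFst_add _ _ _)
    (fun _ _ _ => mulLeftFst_smul _ _ _)
    (fun _ _ _ => by simp [TensorProduct.add_tmul])
    (fun _ _ _ => by simp [← TensorProduct.smul_tmul']))

@[simp] theorem braidOpRight_tmul (z y x : T) :
    braidOpRight c z (y ⊗ₜ[k] x) = mulLeftFst _ y (braiding c (x ⊗ₜ[k] z)) := rfl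

@[simp] theorem braidOp_ι (v : V) : braidOp c (TensorAlgebra.ι k v) = braidOneOp c v := by
  simp [braidOp]

theorem braiding_eq_braidOp (x y : T) :
    braiding c (x ⊗ₜ[k] y) = braidOp c x (y ⊗ₜ[k] 1) := rfl

theorem absorbRight_mulRightSnd (Y : T ⊗[k] V) (x s : T) :
    absorbRight (Y ⊗ₜ[k] (x * s)) = mulRightSnd s (absorbRight (Y ⊗ₜ[k] x)) := by
  induction Y using TensorProduct.induction_on with
  | zero => simp
  | tmul a b => simp [absorbRight_tmul, mul_assoc]
  | add a b ha hb => simp only [TensorProduct.add_tmul, map_add, ha, hb]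

theorem absorbRight_mulLeftFst (Y : T ⊗[k] V) (x t : T) :
    absorbRight (mulLeftFst _ t Y ⊗ₜ[k] x) = mulLeftFst _ t (absorbRight (Y ⊗ₜ[k] x)) := by
  induction Y using TensorProduct.induction_on with
  | zero => simp
  | tmul a b => simp [absorbRight_tmul]
  | add a b ha hb => simp only [TensorProduct.add_tmul, map_add, ha, hb]

theorem absorbLeft_mulLeftFst (Y : V ⊗[k] V) (x t : T) :
    absorbLeft ((t * x) ⊗ₜ[k] Y) = mulLeftFst _ t (absorbLeft (x ⊗ₜ[k] Y)) := by
  induction Y using TensorProduct.induction_on with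
  | zero => simp
  | tmul a b => simp [absorbLeft_tmul, mul_assoc]
  | add a b ha hb => simp only [TensorProduct.tmul_add, map_add, ha, hb]

theorem braidOneOp_mulRightSnd (v : V) (s : T) (X : T ⊗[k] T) :
    braidOneOp c v (mulRightSnd s X) = mulRightSnd s (braidOneOp c v X) := by
  induction X using TensorProduct.induction_on with
  | zero => simp
  | tmul a b => simp [braidOneOp_tmul, absorbRight_mulRightSnd]
  | add a b ha hb => simp only [map_add, ha, hb]

theorem braidOp_mulRightSnd (x s : T) (X : T ⊗[k] T) :
    braidOp c x (mulRightSnd s X) = mulRightSnd s (braidOp c x X) := by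
  induction x using TensorAlgebra.induction generalizing X with
  | algebraMap r => simp [Module.algebraMap_end_apply]
  | ι v => simp [braidOneOp_mulRightSnd]
  | mul a b ha hb => simp [ha, hb]
  | add a b ha hb => simp [ha, hb]

theorem braidOp_tmul (x y w : T) :
    braidOp c x (y ⊗ₜ[k] w) = mulRightSnd w (braiding c (x ⊗ₜ[k] y)) := by
  rw [braiding_eq_braidOp, ← braidOp_mulRightSnd]
  simp

theorem braiding_mul_tmul (x y z : T) :
    braiding c ((x * y) ⊗ₜ[k] z) = braidOp c x (braiding c (y ⊗ₜ[k] z)) := by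
  simp [braiding_eq_braidOp]

theorem passLetter_mulLeftFst (y : V) (t : T) (Y : T ⊗[k] V) :
    passLetter c y (mulLeftFst _ t Y) = mulLeftFst _ t (passLetter c y Y) := by
  induction Y using TensorProduct.induction_on with
  | zero => simp
  | tmul a b => simp [passLetter_tmul, absorbLeft_mulLeftFst]
  | add a b ha hb => simp only [map_add, ha, hb]

theorem passWord_mul (y z : T) (Y : T ⊗[k] V) :
    passWord c (y * z) Y = passWord c z (passWord c y Y) := by
  simp [passWord]

theorem passWord_mulLeftFst (z t : T) (Y : T ⊗[k] V) :
    passWord c z (mulLeftFst _ t Y) = mulLeftFst _ t (passWord c z Y) := by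
  induction z using TensorAlgebra.induction generalizing Y with
  | algebraMap r => simp [passWord, Module.algebraMap_end_apply]
  | ι v => simp [passWord, passLetter_mulLeftFst]
  | mul a b ha hb => simp only [passWord_mul, ha, hb]
  | add a b ha hb =>
    have h (X) : passWord c (a + b) X = passWord c a X + passWord c b X := by simp [passWord]
    simp only [h, ha, hb, map_add]

theorem braidOne_eq_passWord (v : V) (z : T) :
    braidOne c v z = passWord c z (1 ⊗ₜ[k] v) := rfl

theorem passWord_tmul (z t : T) (v : V) :
    passWord c z (t ⊗ₜ[k] v) = mulLeftFst _ t (braidOne c v z) := by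
  rw [braidOne_eq_passWord, ← passWord_mulLeftFst]
  simp

theorem braidOne_mul (v : V) (y z : T) :
    braidOne c v (y * z) = passWord c z (braidOne c v y) := by
  simp only [braidOne_eq_passWord, passWord_mul]

/-- On `y ⊗ x`, with `x` moved in from the left being a letter `v`, both sides cross `v` with `y`
and `x` with `z`, and then `v` with `z`. The first two crossings affect disjoint tensor factors, so
their order is immaterial. -/
theorem braidOp_commute_braidOpRight (x z : T) (X : T ⊗[k] T) :
    braidOp c x (braidOpRight c z X) = braidOpRight c z (braidOp c x X) := by
  induction x using TensorAlgebra.induction generalizing X with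
  | algebraMap r => simp [Module.algebraMap_end_apply]
  | mul a b ha hb => simp [ha, hb]
  | add a b ha hb => simp [ha, hb]
  | ι v =>
    -- `K (t ⊗ v)` moves `v` into its argument and multiplies by `t` from the left. Both sides
    -- become `K` of the crossing of `v` with `y`, applied to the crossing of `x` with `z`.
    let K : T ⊗[k] V →ₗ[k] T ⊗[k] T →ₗ[k] T ⊗[k] T :=
      TensorProduct.lift (LinearMap.mk₂ k (fun t v => mulLeftFst _ t ∘ₗ braidOneOp c v)
        (fun _ _ _ => LinearMap.ext fun _ => mulLeftFst_add _ _ _)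
        (fun _ _ _ => LinearMap.ext fun _ => mulLeftFst_smul _ _ _)
        (fun _ _ _ => by ext; simp)
        (fun _ _ _ => by ext; simp))
    have hK (t : T) (v : V) (Z : T ⊗[k] T) :
        K (t ⊗ₜ[k] v) Z = mulLeftFst _ t (braidOneOp c v Z) := rfl
    have h1 (y : T) (Z : T ⊗[k] T) :
        braidOneOp c v (mulLeftFst _ y Z) = K (braidOne c v y) Z := by
      induction Z using TensorProduct.induction_on with
      | zero => simp
      | add a b ha hb => simp only [map_add, ha, hb]
      | tmul z' x' =>
        rw [mulLeftFst_tmul, braidOneOp_tmul, braidOne_mul]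
        induction braidOne c v y using TensorProduct.induction_on with
        | zero => simp
        | add a b ha hb => simp only [map_add, TensorProduct.add_tmul, LinearMap.add_apply, ha, hb]
        | tmul t v' => rw [passWord_tmul, hK, absorbRight_mulLeftFst, braidOneOp_tmul]
    have h2 (Y : T ⊗[k] V) (x : T) :
        braidOpRight c z (absorbRight (Y ⊗ₜ[k] x)) = K Y (braiding c (x ⊗ₜ[k] z)) := by
      induction Y using TensorProduct.induction_on with
      | zero => simp
      | add a b ha hb => simp only [map_add, TensorProduct.add_tmul, LinearMap.add_apply, ha, hb]
      | tmul t v' => rw [absorbRight_tmul, braidOpRight_tmul, hK, braiding_ι_mul_tmul]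
    induction X using TensorProduct.induction_on with
    | zero => simp
    | add a b ha hb => simp only [map_add, ha, hb]
    | tmul y x => rw [braidOpRight_tmul, braidOp_ι, h1, braidOneOp_tmul, h2]

theorem braiding_tmul_mul (x y z : T) :
    braiding c (x ⊗ₜ[k] (y * z)) = braidOpRight c z (braiding c (x ⊗ₜ[k] y)) := by
  rw [braiding_eq_braidOp c x y, ← braidOp_commute_braidOpRight, braidOpRight_tmul,
    braiding_one_tmul, mulLeftFst_tmul, braiding_eq_braidOp]

theorem braidedMul_tmul_left (x y : T) (Y : T ⊗[k] T) :
    braidedMul c ((x ⊗ₜ[k] y) ⊗ₜ[k] Y) = mulLeftFst _ x (braidOp c y Y) := by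
  induction Y using TensorProduct.induction_on with
  | zero => simp
  | add a b ha hb => simp only [map_add, TensorProduct.tmul_add, ha, hb]
  | tmul z w =>
    rw [braidedMul_tmul, braidOp_tmul]
    induction braiding c (y ⊗ₜ[k] z) using TensorProduct.induction_on with
    | zero => simp
    | add a b ha hb => simp only [map_add, ha, hb]
    | tmul z w => simp

theorem braidedMul_tmul_right (X : T ⊗[k] T) (p q : T) :
    braidedMul c (X ⊗ₜ[k] (p ⊗ₜ[k] q)) = mulRightSnd q (braidOpRight c p X) := by
  induction X using TensorProduct.induction_on with
  | zero => simp
  | add a b ha hb => simp only [map_add, TensorProduct.add_tmul, ha, hb]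
  | tmul z w =>
    rw [braidedMul_tmul_left, braidOp_tmul, mulLeftFst_mulRightSnd, braidOpRight_tmul]

theorem braidOpRight_mulLeftFst (p x : T) (X : T ⊗[k] T) :
    braidOpRight c p (mulLeftFst _ x X) = mulLeftFst _ x (braidOpRight c p X) := by
  induction X using TensorProduct.induction_on with
  | zero => simp
  | add a b ha hb => simp only [map_add, ha, hb]
  | tmul z w =>
    simp only [mulLeftFst_tmul, braidOpRight_tmul]
    induction braiding c (w ⊗ₜ[k] p) using TensorProduct.induction_on with
    | zero => simp
    | add a b ha hb => simp only [map_add, ha, hb]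
    | tmul z w => simp [mul_assoc]

/-- Multiplying by a pure tensor on the left is `braidOp` followed by a left multiplication, and on
the right `braidOpRight` followed by a right multiplication. All four operators of opposite sides
commute. -/
theorem braidedMul_assoc (X Y Z : T ⊗[k] T) :
    braidedMul c (braidedMul c (X ⊗ₜ[k] Y) ⊗ₜ[k] Z) =
      braidedMul c (X ⊗ₜ[k] braidedMul c (Y ⊗ₜ[k] Z)) := by
  induction X using TensorProduct.induction_on with
  | zero => simp
  | add a b ha hb => simp only [map_add, TensorProduct.add_tmul, ha, hb]
  | tmul x y =>
    induction Z using TensorProduct.induction_on with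
    | zero => simp
    | add a b ha hb => simp only [map_add, TensorProduct.tmul_add, ha, hb]
    | tmul p q =>
      rw [braidedMul_tmul_left, braidedMul_tmul_left, braidedMul_tmul_right,
        braidedMul_tmul_right, braidOp_mulRightSnd, braidOp_commute_braidOpRight,
        braidOpRight_mulLeftFst, mulLeftFst_mulRightSnd]

/-- Associativity turns the nested products that define Δ into multiplication by a single element.
This is what makes Δ multiplicative. -/
theorem lift_primitiveMul_apply (x : T) (Y : T ⊗[k] T) :
    TensorAlgebra.lift k (primitiveMul c) x Y = braidedMul c (comul c x ⊗ₜ[k] Y) := by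
  have hc (y : T) : comul c y = TensorAlgebra.lift k (primitiveMul c) y (1 ⊗ₜ[k] 1) := rfl
  have h1 (Y : T ⊗[k] T) : braidedMul c ((1 ⊗ₜ[k] 1) ⊗ₜ[k] Y) = Y := by
    rw [braidedMul_tmul_left, map_one]
    induction Y using TensorProduct.induction_on with
    | zero => simp
    | add a b ha hb => simp only [map_add, ha, hb]
    | tmul z w => simp
  induction x using TensorAlgebra.induction generalizing Y with
  | algebraMap r => simp [hc, Module.algebraMap_end_apply, ← TensorProduct.smul_tmul', h1]
  | ι v => simp [comul_ι, primitiveMul, TensorProduct.add_tmul]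
  | mul a b ha hb =>
    have : comul c (a * b) = braidedMul c (comul c a ⊗ₜ[k] comul c b) := by
      rw [hc, map_mul, Module.End.mul_apply, ← hc, ha]
    rw [map_mul, Module.End.mul_apply, hb, ha, this, braidedMul_assoc]
  | add a b ha hb => simp [ha, hb, TensorProduct.add_tmul]

theorem comul_mul (x y : T) :
    comul c (x * y) = braidedMul c (comul c x ⊗ₜ[k] comul c y) := by
  rw [← lift_primitiveMul_apply]
  simp [comul]

end BraidedProduct

/-! ### Word reversal as an isomorphism onto the opposite, co-opposite bialgebra -/

noncomputable section Reversal

variable {k V : Type*} [Field k] [AddCommGroup V] [Module k V]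

local notation "T" => TensorAlgebra k V

@[simp] theorem reversal_one : reversal (1 : T) = 1 := by simp [reversal]

@[simp] theorem reversal_algebraMap (r : k) : reversal (algebraMap k T r) = algebraMap k T r := by
  simp [reversal]

@[simp] theorem reversal_ι (v : V) :
    reversal (TensorAlgebra.ι k v) = TensorAlgebra.ι k v := by
  simp [reversal]

@[simp] theorem reversal_mul (x y : T) : reversal (x * y) = reversal y * reversal x := by
  simp [reversal]

@[simp] theorem reversal_reversal (x : T) : reversal (reversal x) = x := by
  induction x using TensorAlgebra.induction with
  | algebraMap r => simp
  | ι v => simp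
  | mul a b ha hb => simp [ha, hb]
  | add a b ha hb => simp [ha, hb]

theorem reversal_pow (x : T) (n : ℕ) : reversal (x ^ n) = reversal x ^ n := by
  induction n with
  | zero => simp
  | succ n ih => rw [pow_succ, reversal_mul, ih, pow_succ']

theorem reversal_bijective : Function.Bijective (reversal (k := k) (V := V)) :=
  Function.Involutive.bijective reversal_reversal

theorem reversal_prod (l : List V) : reversal (l.map (TensorAlgebra.ι k)).prod =
    (l.reverse.map (TensorAlgebra.ι k)).prod := by
  induction l with
  | nil => simp
  | cons v l ih => simp [ih]

variable (c : V ⊗[k] V ≃ₗ[k] V ⊗[k] V)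

theorem braidOpRight_mul (y z : T) (X : T ⊗[k] T) :
    braidOpRight c (y * z) X = braidOpRight c z (braidOpRight c y X) := by
  induction X using TensorProduct.induction_on with
  | zero => simp
  | add a b ha hb => simp only [map_add, ha, hb]
  | tmul p q => rw [braidOpRight_tmul, braiding_tmul_mul, braidOpRight_tmul,
      braidOpRight_mulLeftFst]

theorem braidOpRight_add (y z : T) (X : T ⊗[k] T) :
    braidOpRight c (y + z) X = braidOpRight c y X + braidOpRight c z X := by
  induction X using TensorProduct.induction_on with
  | zero => simp
  | add a b ha hb => simp only [map_add, ha, hb]; abel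
  | tmul p q => simp [TensorProduct.tmul_add]

theorem braidOpRight_algebraMap (r : k) (X : T ⊗[k] T) :
    braidOpRight c (algebraMap k T r) X = r • X := by
  have h (q : T) : braiding c (q ⊗ₜ[k] 1) = 1 ⊗ₜ[k] q := by
    induction q using TensorAlgebra.induction with
    | algebraMap r =>
      rw [Algebra.algebraMap_eq_smul_one, ← TensorProduct.smul_tmul', map_smul, braiding_one_tmul,
        TensorProduct.tmul_smul]
    | ι v => simp [braiding_ι_tmul, braidOne_one]
    | mul a b ha hb => rw [braiding_mul_tmul, hb, braidOp_tmul, ha, mulRightSnd_tmul]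
    | add a b ha hb => rw [TensorProduct.add_tmul, map_add, ha, hb, TensorProduct.tmul_add]
  induction X using TensorProduct.induction_on with
  | zero => simp
  | add a b ha hb => simp only [map_add, ha, hb, smul_add]
  | tmul p q =>
    rw [braidOpRight_tmul, Algebra.algebraMap_eq_smul_one, TensorProduct.tmul_smul, map_smul, h,
      map_smul, mulLeftFst_tmul, mul_one]

theorem comm_comm_apply (X : T ⊗[k] T) :
    TensorProduct.comm k T T (TensorProduct.comm k T T X) = X :=
  (TensorProduct.comm k T T).symm_apply_apply X

/-- The mirror image of a letter moving right past a word is the reversed word moving past that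
letter, with `c` mirrored to `τcτ`. It suffices to check one letter of the word at a time. -/
theorem map_reversal_passWord (z : T) (Y : T ⊗[k] V) :
    TensorProduct.map reversal reversal
        ((TensorAlgebra.ι k).lTensor T (passWord c z Y)) =
      TensorProduct.comm k T T (braidOp (flipConj c) (reversal z)
        (TensorProduct.comm k T T (TensorProduct.map reversal reversal
          ((TensorAlgebra.ι k).lTensor T Y)))) := by
  induction z using TensorAlgebra.induction generalizing Y with
  | algebraMap r =>
    have : passWord c (algebraMap k T r) Y = r • Y := by
      simp [passWord, Module.algebraMap_end_apply]
    rw [this, reversal_algebraMap, AlgHom.commutes, Module.algebraMap_end_apply]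
    simp
  | mul a b ha hb => rw [passWord_mul, hb, ha, reversal_mul, map_mul]; simp
  | add a b ha hb =>
    have h (X) : passWord c (a + b) X = passWord c a X + passWord c b X := by simp [passWord]
    simp only [h, ha, hb, map_add, LinearMap.add_apply]
  | ι u =>
    have h (X) : passWord c (TensorAlgebra.ι k u) X = passLetter c u X := by simp [passWord]
    rw [h, reversal_ι, braidOp_ι]
    induction Y using TensorProduct.induction_on with
    | zero => simp
    | add a b ha hb => simp only [map_add, ha, hb]
    | tmul t v =>
      rw [passLetter_tmul, LinearMap.lTensor_tmul, TensorProduct.map_tmul,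
        TensorProduct.comm_tmul, braidOneOp_tmul, reversal_ι, braidOne_ι]
      have : flipConj c (u ⊗ₜ[k] v) = TensorProduct.comm k V V (c (v ⊗ₜ[k] u)) := by
        simp [flipConj]
      rw [this]
      induction c (v ⊗ₜ[k] u) using TensorProduct.induction_on with
      | zero => simp
      | add a b ha hb => simp only [map_add, TensorProduct.tmul_add, TensorProduct.add_tmul, ha, hb]
      | tmul p q => simp [absorbLeft_tmul, absorbRight_tmul]

/-- Mirroring exchanges the two sides from which a word enters. The case of a single letter is
`map_reversal_passWord`, and products then follow on both sides. -/
theorem map_reversal_braidOp (x : T) (Z : T ⊗[k] T) :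
    TensorProduct.map reversal reversal (braidOp c x Z) =
      TensorProduct.comm k T T (braidOpRight (flipConj c) (reversal x)
        (TensorProduct.comm k T T (TensorProduct.map reversal reversal Z))) := by
  induction x using TensorAlgebra.induction generalizing Z with
  | algebraMap r =>
    rw [reversal_algebraMap, braidOpRight_algebraMap, AlgHom.commutes,
      Module.algebraMap_end_apply]
    simp
  | mul a b ha hb => rw [map_mul, Module.End.mul_apply, ha, hb, reversal_mul, braidOpRight_mul]; simp
  | add a b ha hb =>
    rw [map_add, map_add, braidOpRight_add, LinearMap.add_apply, map_add, map_add, ha, hb]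
  | ι v =>
    induction Z using TensorProduct.induction_on with
    | zero => simp
    | add a b ha hb => simp only [map_add, ha, hb]
    | tmul z w =>
      have h := map_reversal_passWord c z (1 ⊗ₜ[k] v)
      rw [← braidOne_eq_passWord, ← braiding_ι_tmul, LinearMap.lTensor_tmul,
        TensorProduct.map_tmul, TensorProduct.comm_tmul, reversal_one, reversal_ι,
        ← braiding_eq_braidOp] at h
      replace h := congrArg (TensorProduct.comm k T T) h
      rw [comm_comm_apply] at h
      rw [braidOp_tmul, reversal_ι, TensorProduct.map_tmul, TensorProduct.comm_tmul,
        braidOpRight_tmul, ← h]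
      induction braiding c (TensorAlgebra.ι k v ⊗ₜ[k] z) using TensorProduct.induction_on with
      | zero => simp
      | add a b ha hb => simp only [map_add, ha, hb]
      | tmul p q => simp

theorem map_reversal_braidedMul (X Y : T ⊗[k] T) :
    TensorProduct.map reversal reversal (braidedMul c (X ⊗ₜ[k] Y)) =
      TensorProduct.comm k T T (braidedMul (flipConj c)
        (TensorProduct.comm k T T (TensorProduct.map reversal reversal Y) ⊗ₜ[k]
          TensorProduct.comm k T T (TensorProduct.map reversal reversal X))) := by
  induction X using TensorProduct.induction_on with
  | zero => simp
  | add a b ha hb => simp only [map_add, TensorProduct.add_tmul, TensorProduct.tmul_add, ha, hb]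
  | tmul x y =>
    have h := congrArg (TensorProduct.comm k T T) (map_reversal_braidOp c y Y)
    rw [comm_comm_apply] at h
    rw [braidedMul_tmul_left, TensorProduct.map_tmul, TensorProduct.comm_tmul,
      braidedMul_tmul_right, ← h]
    induction braidOp c y Y using TensorProduct.induction_on with
    | zero => simp
    | add a b ha hb => simp only [map_add, ha, hb]
    | tmul p q => simp

theorem map_reversal_comul (x : T) :
    TensorProduct.map reversal reversal (comul c x) =
      TensorProduct.comm k T T (comul (flipConj c) (reversal x)) := by
  induction x using TensorAlgebra.induction with
  | algebraMap r =>
    rw [reversal_algebraMap, Algebra.algebraMap_eq_smul_one]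
    simp [comul_one]
  | ι v => simp [comul_ι, add_comm]
  | mul a b ha hb =>
    rw [comul_mul, map_reversal_braidedMul, ha, hb, reversal_mul, comul_mul,
      comm_comm_apply, comm_comm_apply]
  | add a b ha hb => simp only [map_add, ha, hb]

theorem isIsoToOpCop_reversal : IsIsoToOpCop c (reversal (k := k) (V := V)) where
  bijective := reversal_bijective
  map_one := reversal_one
  map_mul := reversal_mul
  map_comul := map_reversal_comul c
  map_counit x := by
    induction x using TensorAlgebra.induction with
    | algebraMap r => simp
    | ι v => simp
    | mul a b ha hb => rw [reversal_mul, map_mul, map_mul, ha, hb, mul_comm]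
    | add a b ha hb => simp only [map_add, ha, hb]
  map_braiding z := by
    induction z using TensorProduct.induction_on with
    | zero => simp
    | add a b ha hb => simp only [map_add, ha, hb]
    | tmul x y =>
      rw [braiding_eq_braidOp, map_reversal_braidOp]
      simp [mulLeftFst]

end Reversal

/-! ### Triangularity of the braiding on words -/

noncomputable section Triangular

set_option linter.unusedSectionVars false

theorem map_mem_of_mem_span {R M N : Type*} [Semiring R] [AddCommMonoid M] [AddCommMonoid N]
    [Module R M] [Module R N] (f : M →ₗ[R] N) {s : Set M} {P : Submodule R N} {x : M}
    (hx : x ∈ Submodule.span R s) (h : ∀ y ∈ s, f y ∈ P) : f x ∈ P :=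
  (Submodule.span_le (p := P.comap f)).2 h hx

variable {k V ι : Type*} [Field k] [AddCommGroup V] [Module k V] [LinearOrder ι]

local notation "T" => TensorAlgebra k V

/-- `d (x ⊗ y) ∈ α x y • (y ⊗ x) + ∑_{z > y} z ⊗ V` for basis vectors `x`, `y`, where
`α x y ≠ 0`. -/
structure IsLeftTriangular (b : Module.Basis ι k V) (d : V ⊗[k] V ≃ₗ[k] V ⊗[k] V)
    (α : ι → ι → k) : Prop where
  ne_zero : ∀ x y, α x y ≠ 0
  triangular : ∀ x y, d (b x ⊗ₜ[k] b y) - α x y • (b y ⊗ₜ[k] b x) ∈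
    Submodule.span k ((fun p : ι × ι => b p.1 ⊗ₜ[k] b p.2) '' {p | y < p.1})

theorem tmul_mem_span_basis (b : Module.Basis ι k V) (v : V) (y : ι) {A : Set (ι × ι)}
    (hA : ∀ x, (y, x) ∈ A) :
    b y ⊗ₜ[k] v ∈ Submodule.span k ((fun p : ι × ι => b p.1 ⊗ₜ[k] b p.2) '' A) := by
  have hv : v ∈ Submodule.span k (Set.range b) := by rw [b.span_eq]; trivial
  refine map_mem_of_mem_span (TensorProduct.mk k V V (b y)) hv ?_
  rintro _ ⟨x, rfl⟩
  exact Submodule.subset_span ⟨(y, x), hA x, rfl⟩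

/-- The triangular shape follows by flipping. That the diagonal coefficients are nonzero uses that
`c` is bijective and `V` finite-dimensional. -/
theorem IsRightTriangular.exists_isLeftTriangular [Fintype ι] {b : Module.Basis ι k V}
    {c : V ⊗[k] V ≃ₗ[k] V ⊗[k] V} (h : IsRightTriangular b c) :
    ∃ α, IsLeftTriangular b (flipConj c) α := by
  obtain ⟨β, w, hβ⟩ := h
  have hfin : Module.Finite k V := Module.Finite.of_basis b
  let U (x : ι) : Submodule k (V ⊗[k] V) :=
    Submodule.span k ((fun p : ι × ι => b p.1 ⊗ₜ[k] b p.2) '' {p | x < p.1})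
  let τ := TensorProduct.comm k V V
  -- `c` maps `U x` into its flip by triangularity, and onto it because the dimensions agree.
  have hU (x : ι) : (U x).map c.toLinearMap = (U x).map τ.toLinearMap := by
    refine Submodule.eq_of_le_of_finrank_eq ?_ ?_
    · rw [Submodule.map_le_iff_le_comap]
      refine Submodule.span_le.2 ?_
      rintro _ ⟨⟨x', y'⟩, hx : x < x', rfl⟩
      rw [SetLike.mem_coe, Submodule.mem_comap, LinearEquiv.coe_coe, hβ]
      refine Submodule.add_mem _ (Submodule.smul_mem _ _ ?_) (Submodule.sum_mem _ fun z hz => ?_)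
      · exact ⟨b x' ⊗ₜ[k] b y', Submodule.subset_span ⟨(x', y'), hx, rfl⟩, rfl⟩
      · exact ⟨b z ⊗ₜ[k] w x' y' z, tmul_mem_span_basis b _ _ fun t =>
          hx.trans (Finset.mem_filter.1 hz).2, rfl⟩
    · rw [LinearEquiv.finrank_map_eq, LinearEquiv.finrank_map_eq]
  refine ⟨fun x y => β y x, fun x y h0 => ?_, fun x y => ?_⟩
  -- With a vanishing coefficient the image lies in the flip of `U y`, which is `c (U y)`.
  -- Injectivity then puts `b y ⊗ b x` into `U y`, whose first letters are strictly larger than `y`.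
  · have h1 : c (b y ⊗ₜ[k] b x) ∈ (U y).map c.toLinearMap := by
      rw [hU, hβ, h0, zero_smul, zero_add]
      exact Submodule.sum_mem _ fun z hz => ⟨b z ⊗ₜ[k] w y x z, tmul_mem_span_basis b _ _ fun t =>
        (Finset.mem_filter.1 hz).2, rfl⟩
    obtain ⟨X, hX, hXc⟩ := h1
    rw [c.injective hXc] at hX
    have h2 : (b.tensorProduct b) (y, x) ∈
        Submodule.span k (b.tensorProduct b '' {p | y < p.1}) := by
      have : (fun p : ι × ι => b p.1 ⊗ₜ[k] b p.2) = b.tensorProduct b :=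
        funext fun p => (b.tensorProduct_apply' b p).symm
      rw [b.tensorProduct_apply, ← this]; exact hX
    rw [Module.Basis.mem_span_image] at h2
    have h3 : (y, x) ∈ ((b.tensorProduct b).repr (b.tensorProduct b (y, x))).support := by
      rw [Module.Basis.repr_self]; simp
    exact lt_irrefl y (h2 h3)
  · have : flipConj c (b x ⊗ₜ[k] b y) = τ (c (b y ⊗ₜ[k] b x)) := by simp [flipConj, τ]
    rw [this, hβ, map_add, map_smul, map_sum]
    simp only [τ, TensorProduct.comm_tmul, add_sub_cancel_left]
    exact Submodule.sum_mem _ fun z hz => tmul_mem_span_basis b _ _ fun t =>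
      (Finset.mem_filter.1 hz).2

/-- The product of the letters of a word in `T(V)`. -/
def wordElem (b : Module.Basis ι k V) (u : List ι) : T := b.tensorAlgebra (FreeMonoid.ofList u)

theorem wordElem_eq_prod (b : Module.Basis ι k V) (u : List ι) :
    wordElem b u = (u.map (fun i => TensorAlgebra.ι k (b i))).prod :=
  tensorAlgebra_basis_eq_prod b (FreeMonoid.ofList u)

@[simp] theorem wordElem_nil (b : Module.Basis ι k V) : wordElem b [] = 1 := by
  simp [wordElem_eq_prod]

theorem wordElem_append (b : Module.Basis ι k V) (u v : List ι) :
    wordElem b (u ++ v) = wordElem b u * wordElem b v := by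
  simp [wordElem_eq_prod]

theorem wordElem_cons (b : Module.Basis ι k V) (x : ι) (v : List ι) :
    wordElem b (x :: v) = TensorAlgebra.ι k (b x) * wordElem b v := by
  simp [wordElem_eq_prod]

theorem wordElem_singleton (b : Module.Basis ι k V) (x : ι) :
    wordElem b [x] = TensorAlgebra.ι k (b x) := by
  simp [wordElem_eq_prod]

/-- The span of a set of words. -/
def wordSpan (b : Module.Basis ι k V) (A : Set (List ι)) : Submodule k T :=
  Submodule.span k (wordElem b '' A)

/-- The span of the tensor products of a set of pairs of words. -/
def pairSpan (b : Module.Basis ι k V) (A : Set (List ι × List ι)) : Submodule k (T ⊗[k] T) :=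
  Submodule.span k ((fun p => wordElem b p.1 ⊗ₜ[k] wordElem b p.2) '' A)

/-- The span in `T(V) ⊗ V` of the tensor products of a set of words and letters. -/
def letterSpan (b : Module.Basis ι k V) (A : Set (List ι × ι)) : Submodule k (T ⊗[k] V) :=
  Submodule.span k ((fun p => wordElem b p.1 ⊗ₜ[k] b p.2) '' A)

variable {b : Module.Basis ι k V}

theorem wordElem_mem {A : Set (List ι)} {u : List ι} (h : u ∈ A) :
    wordElem b u ∈ wordSpan b A :=
  Submodule.subset_span ⟨u, h, rfl⟩

theorem tmul_mem_pairSpan {A : Set (List ι × List ι)} {u v : List ι} (h : (u, v) ∈ A) :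
    wordElem b u ⊗ₜ[k] wordElem b v ∈ pairSpan b A :=
  Submodule.subset_span ⟨(u, v), h, rfl⟩

theorem tmul_mem_letterSpan {A : Set (List ι × ι)} {u : List ι} {x : ι} (h : (u, x) ∈ A) :
    wordElem b u ⊗ₜ[k] b x ∈ letterSpan b A :=
  Submodule.subset_span ⟨(u, x), h, rfl⟩

theorem wordSpan_mono {A B : Set (List ι)} (h : A ⊆ B) : wordSpan b A ≤ wordSpan b B :=
  Submodule.span_mono (Set.image_mono h)

theorem pairSpan_mono {A B : Set (List ι × List ι)} (h : A ⊆ B) :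
    pairSpan b A ≤ pairSpan b B :=
  Submodule.span_mono (Set.image_mono h)

theorem letterSpan_mono {A B : Set (List ι × ι)} (h : A ⊆ B) :
    letterSpan b A ≤ letterSpan b B :=
  Submodule.span_mono (Set.image_mono h)

theorem map_mem_of_wordSpan {M : Type*} [AddCommGroup M] [Module k M] (f : T →ₗ[k] M)
    {A : Set (List ι)} {P : Submodule k M} {x : T} (hx : x ∈ wordSpan b A)
    (h : ∀ u ∈ A, f (wordElem b u) ∈ P) : f x ∈ P :=
  map_mem_of_mem_span f hx (by rintro _ ⟨u, hu, rfl⟩; exact h u hu)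

theorem map_mem_of_pairSpan {M : Type*} [AddCommGroup M] [Module k M] (f : T ⊗[k] T →ₗ[k] M)
    {A : Set (List ι × List ι)} {P : Submodule k M} {x : T ⊗[k] T} (hx : x ∈ pairSpan b A)
    (h : ∀ u v, (u, v) ∈ A → f (wordElem b u ⊗ₜ[k] wordElem b v) ∈ P) : f x ∈ P :=
  map_mem_of_mem_span f hx (by rintro _ ⟨⟨u, v⟩, hu, rfl⟩; exact h u v hu)

theorem map_mem_of_letterSpan {M : Type*} [AddCommGroup M] [Module k M] (f : T ⊗[k] V →ₗ[k] M)
    {A : Set (List ι × ι)} {P : Submodule k M} {x : T ⊗[k] V} (hx : x ∈ letterSpan b A)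
    (h : ∀ u v, (u, v) ∈ A → f (wordElem b u ⊗ₜ[k] b v) ∈ P) : f x ∈ P :=
  map_mem_of_mem_span f hx (by rintro _ ⟨⟨u, v⟩, hu, rfl⟩; exact h u v hu)

/-- `z'` is a word of the same length as `z` and lexicographically at least as large. -/
def Raises (z z' : List ι) : Prop := (z' = z ∨ Diverges z z') ∧ z'.length = z.length

theorem Raises.trans_diverges {w z z' : List ι} (h : Raises z z') (hw : Diverges w z) :
    Diverges w z' := by
  rcases h.1 with rfl | h
  · exact hw
  · exact hw.trans h

theorem absorbLeft_mem (z : List ι) {B : Set (ι × ι)} {A : Set (List ι × ι)} {X : V ⊗[k] V}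
    (hX : X ∈ Submodule.span k ((fun p : ι × ι => b p.1 ⊗ₜ[k] b p.2) '' B))
    (h : ∀ y t, (y, t) ∈ B → (z ++ [y], t) ∈ A) :
    absorbLeft (wordElem b z ⊗ₜ[k] X) ∈ letterSpan b A := by
  refine map_mem_of_mem_span (absorbLeft ∘ₗ TensorProduct.mk k T (V ⊗[k] V) (wordElem b z)) hX ?_
  rintro _ ⟨⟨y, t⟩, hy, rfl⟩
  rw [LinearMap.comp_apply, TensorProduct.mk_apply, absorbLeft_tmul, ← wordElem_singleton,
    ← wordElem_append]
  exact tmul_mem_letterSpan (h y t hy)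

theorem mem_span_basis_tmul (b : Module.Basis ι k V) (X : V ⊗[k] V) :
    X ∈ Submodule.span k ((fun p : ι × ι => b p.1 ⊗ₜ[k] b p.2) '' Set.univ) := by
  have : (fun p : ι × ι => b p.1 ⊗ₜ[k] b p.2) = b.tensorProduct b :=
    funext fun p => (b.tensorProduct_apply' b p).symm
  rw [this, Set.image_univ, Module.Basis.span_eq]
  trivial

namespace IsLeftTriangular

variable {d : V ⊗[k] V ≃ₗ[k] V ⊗[k] V} {α : ι → ι → k} (hd : IsLeftTriangular b d α)
include hd

/-- Once a term exceeds `z` at some letter, later crossings only append letters and cannot undo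
this. So only the diagonal term needs the triangularity of `d`. -/
theorem braidOne_sub_mem (x : ι) (z : List ι) :
    braidOne d (b x) (wordElem b z) - (z.map (α x)).prod • (wordElem b z ⊗ₜ[k] b x) ∈
      letterSpan b {p | Diverges z p.1 ∧ p.1.length = z.length} := by
  induction z using List.reverseRecOn with
  | nil => simp [braidOne_one]
  | append_singleton z y ih =>
    rw [wordElem_append, wordElem_singleton, braidOne_mul_ι]
    have h1 : passLetter d (b y) (wordElem b z ⊗ₜ[k] b x) -
        α x y • ((wordElem b z * TensorAlgebra.ι k (b y)) ⊗ₜ[k] b x) ∈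
        letterSpan b {p | Diverges (z ++ [y]) p.1 ∧ p.1.length = (z ++ [y]).length} := by
      rw [passLetter_tmul, ← absorbLeft_tmul, ← map_smul, ← TensorProduct.tmul_smul, ← map_sub,
        ← TensorProduct.tmul_sub]
      exact absorbLeft_mem z (hd.triangular x y) fun y' t (h : y < y') =>
        ⟨(Diverges.rel h).prepend z, by simp⟩
    have h2 := map_mem_of_letterSpan (passLetter d (b y)) ih
      (P := letterSpan b {p | Diverges (z ++ [y]) p.1 ∧ p.1.length = (z ++ [y]).length})
      fun u t h => by
        rw [passLetter_tmul]
        exact absorbLeft_mem u (mem_span_basis_tmul b _) fun y' t _ =>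
          ⟨h.1.append _ _, by simp [h.2]⟩
    rw [map_sub, map_smul] at h2
    convert Submodule.add_mem _ h2 (Submodule.smul_mem _ (z.map (α x)).prod h1) using 1
    rw [smul_sub, smul_smul, List.map_append, List.prod_append]
    simp

theorem braidOne_mem (x : ι) (z : List ι) :
    braidOne d (b x) (wordElem b z) ∈ letterSpan b {p | Raises z p.1} := by
  rw [← sub_add_cancel (braidOne d (b x) (wordElem b z))
    ((z.map (α x)).prod • (wordElem b z ⊗ₜ[k] b x))]
  refine Submodule.add_mem _ (letterSpan_mono ?_ (hd.braidOne_sub_mem x z))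
    (Submodule.smul_mem _ _ (tmul_mem_letterSpan ⟨.inl rfl, rfl⟩))
  exact fun p hp => ⟨.inr hp.1, hp.2⟩

end IsLeftTriangular

theorem absorbRight_mem (t : List ι) {B : Set (List ι × ι)} {A : Set (List ι × List ι)}
    {X : T ⊗[k] V} (hX : X ∈ letterSpan b B) (h : ∀ z x, (z, x) ∈ B → (z, x :: t) ∈ A) :
    absorbRight (X ⊗ₜ[k] wordElem b t) ∈ pairSpan b A := by
  refine map_mem_of_letterSpan
    (absorbRight ∘ₗ (TensorProduct.mk k (T ⊗[k] V) T).flip (wordElem b t)) hX fun z x hz => ?_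
  rw [LinearMap.comp_apply, LinearMap.flip_apply, TensorProduct.mk_apply, absorbRight_tmul,
    ← wordElem_cons]
  exact tmul_mem_pairSpan (h z x hz)

/-- The scalar by which the word `t` is moved past the word `z`. -/
def braidScalar (α : ι → ι → k) (t z : List ι) : k := (t.map fun x => (z.map (α x)).prod).prod

theorem braidScalar_perm (α : ι → ι → k) {t t' : List ι} (h : t.Perm t') (z : List ι) :
    braidScalar α t z = braidScalar α t' z :=
  (h.map _).prod_eq

namespace IsLeftTriangular

variable {d : V ⊗[k] V ≃ₗ[k] V ⊗[k] V} {α : ι → ι → k} (hd : IsLeftTriangular b d α)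
include hd

theorem braidScalar_ne_zero (t z : List ι) : braidScalar α t z ≠ 0 := by
  refine List.prod_ne_zero fun h => ?_
  obtain ⟨x, -, hx⟩ := List.mem_map.1 h
  obtain ⟨y, -, hy⟩ := List.mem_map.1 (List.prod_eq_zero_iff.1 hx)
  exact hd.ne_zero x y hy

theorem braiding_sub_mem (t z : List ι) :
    braiding d (wordElem b t ⊗ₜ[k] wordElem b z) -
        braidScalar α t z • (wordElem b z ⊗ₜ[k] wordElem b t) ∈
      pairSpan b {p | Diverges z p.1 ∧ p.1.length = z.length ∧ p.2.length = t.length} := by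
  induction t with
  | nil => simp [braiding_one_tmul, braidScalar]
  | cons x t ih =>
    rw [wordElem_cons, braiding_ι_mul_tmul]
    set A := {p : List ι × List ι |
      Diverges z p.1 ∧ p.1.length = z.length ∧ p.2.length = (x :: t).length}
    have h1 : braidOneOp d (b x) (wordElem b z ⊗ₜ[k] wordElem b t) -
        (z.map (α x)).prod • (wordElem b z ⊗ₜ[k] (TensorAlgebra.ι k (b x) * wordElem b t)) ∈
        pairSpan b A := by
      rw [braidOneOp_tmul, ← absorbRight_tmul, ← map_smul, TensorProduct.smul_tmul', ← map_sub,
        ← TensorProduct.sub_tmul]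
      exact absorbRight_mem t (hd.braidOne_sub_mem x z) fun z' x' h => ⟨h.1, h.2, by simp⟩
    have h2 := map_mem_of_pairSpan (braidOneOp d (b x)) ih (P := pairSpan b A) fun u v h => by
      rw [braidOneOp_tmul]
      exact absorbRight_mem v (hd.braidOne_mem x u) fun z' x' hz =>
        ⟨Raises.trans_diverges hz h.1, hz.2.trans h.2.1, by simp [h.2.2]⟩
    rw [map_sub, map_smul] at h2
    convert Submodule.add_mem _ h2 (Submodule.smul_mem _ (braidScalar α t z) h1) using 1
    rw [smul_sub, smul_smul]
    simp [braidScalar, mul_comm]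

theorem braiding_mem (t z : List ι) :
    braiding d (wordElem b t ⊗ₜ[k] wordElem b z) ∈
      pairSpan b {p | Raises z p.1 ∧ p.2.length = t.length} := by
  rw [← sub_add_cancel (braiding d (wordElem b t ⊗ₜ[k] wordElem b z))
    (braidScalar α t z • (wordElem b z ⊗ₜ[k] wordElem b t))]
  refine Submodule.add_mem _ (pairSpan_mono ?_ (hd.braiding_sub_mem t z))
    (Submodule.smul_mem _ _ (tmul_mem_pairSpan ⟨⟨.inl rfl, rfl⟩, rfl⟩))
  exact fun p hp => ⟨⟨.inr hp.1, hp.2.1⟩, hp.2.2⟩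

theorem braidedMul_mem {A B C : Set (List ι × List ι)} {X Y : T ⊗[k] T}
    (hX : X ∈ pairSpan b A) (hY : Y ∈ pairSpan b B)
    (h : ∀ x y z w z' y', (x, y) ∈ A → (z, w) ∈ B → Raises z z' → y'.length = y.length →
      (x ++ z', y' ++ w) ∈ C) :
    braidedMul d (X ⊗ₜ[k] Y) ∈ pairSpan b C := by
  refine map_mem_of_pairSpan
    (braidedMul d ∘ₗ (TensorProduct.mk k (T ⊗[k] T) (T ⊗[k] T)).flip Y) hX fun x y hxy => ?_
  refine map_mem_of_pairSpan (braidedMul d ∘ₗ TensorProduct.mk k (T ⊗[k] T) (T ⊗[k] T)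
    (wordElem b x ⊗ₜ[k] wordElem b y)) hY fun z w hzw => ?_
  rw [LinearMap.comp_apply, TensorProduct.mk_apply, braidedMul_tmul]
  refine map_mem_of_pairSpan _ (hd.braiding_mem y z) fun z' y' hz => ?_
  rw [TensorProduct.map_tmul, LinearMap.mulLeft_apply, LinearMap.mulRight_apply,
    ← wordElem_append, ← wordElem_append]
  exact tmul_mem_pairSpan (h x y z w z' y' hxy hzw hz.1 hz.2)

/-- The scalar depends only on the multiset of letters of the left word. This is why leading words
are tracked together with rearrangements. -/
theorem braiding_tmul_sub_mem {t : List ι} {g : T} (hg : g ∈ wordSpan b {u | u.Perm t})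
    (z : List ι) :
    braiding d (g ⊗ₜ[k] wordElem b z) - braidScalar α t z • (wordElem b z ⊗ₜ[k] g) ∈
      pairSpan b {p | Diverges z p.1 ∧ p.1.length = z.length ∧ p.2.length = t.length} := by
  refine map_mem_of_wordSpan (braiding d ∘ₗ (TensorProduct.mk k T T).flip (wordElem b z) -
    braidScalar α t z • TensorProduct.mk k T T (wordElem b z)) hg fun u hu => ?_
  have := hd.braiding_sub_mem u z
  rw [braidScalar_perm α hu, List.Perm.length_eq hu] at this
  exact this

theorem comul_mem (u : List ι) :
    comul d (wordElem b u) ∈ pairSpan b {p | p.1.length + p.2.length = u.length} := by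
  induction u with
  | nil =>
    rw [wordElem_nil, comul_one, ← wordElem_nil b]
    exact tmul_mem_pairSpan rfl
  | cons x u ih =>
    rw [wordElem_cons, comul_mul, comul_ι, ← wordElem_singleton, ← wordElem_nil b]
    refine hd.braidedMul_mem (A := {p | p.1.length + p.2.length = 1})
      (Submodule.add_mem _ (tmul_mem_pairSpan rfl) (tmul_mem_pairSpan rfl)) ih
      fun x y z w z' y' h1 h2 h3 h4 => ?_
    have := h3.2
    simp only [Set.mem_ofPred_eq, List.length_append, List.length_cons] at *
    omega

theorem comul_mem_of_mem {g : T} {n : ℕ} (hg : g ∈ wordSpan b {u | u.length = n}) :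
    comul d g ∈ pairSpan b {p | p.1.length + p.2.length = n} :=
  map_mem_of_wordSpan (comul d) hg fun u (hu : u.length = n) => hu ▸ hd.comul_mem u

end IsLeftTriangular

end Triangular

/-! ### Braided commutators attached to Lyndon words -/

noncomputable section LyndonElements

variable {k V ι : Type*} [Field k] [AddCommGroup V] [Module k V] [LinearOrder ι]

local notation "T" => TensorAlgebra k V

/-- `g` is the sum of the word `w` and a linear combination of larger rearrangements of `w`. -/
def HasLeadingWord (b : Module.Basis ι k V) (w : List ι) (g : T) : Prop :=
  g - wordElem b w ∈ wordSpan b {z | z.Perm w ∧ Diverges w z}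

variable {b : Module.Basis ι k V}

theorem HasLeadingWord.mem {w : List ι} {g : T} (h : HasLeadingWord b w g) :
    g ∈ wordSpan b {z | z.Perm w} := by
  rw [← sub_add_cancel g (wordElem b w)]
  exact Submodule.add_mem _ (wordSpan_mono (fun z hz => hz.1) h) (wordElem_mem (List.Perm.refl w))

theorem HasLeadingWord.mem_length {w : List ι} {g : T} (h : HasLeadingWord b w g) :
    g ∈ wordSpan b {z | z.length = w.length} :=
  wordSpan_mono (fun _ hz => List.Perm.length_eq hz) h.mem

theorem hasLeadingWord_self (w : List ι) : HasLeadingWord b w (wordElem b w) := by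
  simp [HasLeadingWord]

theorem mul_mem_wordSpan {A B C : Set (List ι)} {x y : T} (hx : x ∈ wordSpan b A)
    (hy : y ∈ wordSpan b B) (h : ∀ u v, u ∈ A → v ∈ B → u ++ v ∈ C) : x * y ∈ wordSpan b C := by
  refine map_mem_of_wordSpan (LinearMap.mulRight k y) hx fun u hu => ?_
  refine map_mem_of_wordSpan (LinearMap.mulLeft k (wordElem b u)) hy fun v hv => ?_
  rw [LinearMap.mulLeft_apply, ← wordElem_append]
  exact wordElem_mem (h u v hu hv)

theorem HasLeadingWord.mul {u v : List ι} {g h : T} (hg : HasLeadingWord b u g)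
    (hh : HasLeadingWord b v h) : HasLeadingWord b (u ++ v) (g * h) := by
  have : g * h - wordElem b (u ++ v) =
      (g - wordElem b u) * h + wordElem b u * (h - wordElem b v) := by
    rw [wordElem_append]; noncomm_ring
  rw [HasLeadingWord, this]
  refine Submodule.add_mem _ (mul_mem_wordSpan hg hh.mem fun x y hx hy => ?_)
    (mul_mem_wordSpan (wordElem_mem (Set.mem_singleton u)) hh fun x y hx hy => ?_)
  · exact ⟨List.Perm.append hx.1 hy, hx.2.append _ _⟩
  · rw [Set.mem_singleton_iff.1 hx]
    exact ⟨hy.1.append_left u, hy.2.prepend u⟩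

theorem one_tmul_mem_pairSpan {A : Set (List ι)} {B : Set (List ι × List ι)} {g : T}
    (hg : g ∈ wordSpan b A) (h : ∀ t ∈ A, ([], t) ∈ B) :
    (1 : T) ⊗ₜ[k] g ∈ pairSpan b B := by
  refine map_mem_of_wordSpan (TensorProduct.mk k T T 1) hg fun t ht => ?_
  rw [TensorProduct.mk_apply, ← wordElem_nil b]
  exact tmul_mem_pairSpan (h t ht)

variable (b) in
/-- `g` has the leading word `w`, and `Δ g ∈ 1 ⊗ g + w ⊗ 1 + ∑ z ⊗ T(V)`, with words `z` that
exceed `w`. -/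
structure IsLyndonElement (d : V ⊗[k] V ≃ₗ[k] V ⊗[k] V) (w : List ι) (g : T) : Prop where
  leading : HasLeadingWord b w g
  comul : comul d g - 1 ⊗ₜ[k] g - wordElem b w ⊗ₜ[k] 1 ∈
    pairSpan b {p | Diverges w p.1 ∧ p.1.length + p.2.length = w.length}

theorem braidedMul_one_tmul_one_tmul (d : V ⊗[k] V ≃ₗ[k] V ⊗[k] V) (x y : T) :
    braidedMul d ((1 ⊗ₜ[k] x) ⊗ₜ[k] (1 ⊗ₜ[k] y)) = 1 ⊗ₜ[k] (x * y) := by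
  rw [braidedMul_tmul_right]
  have := braidOpRight_algebraMap d 1 ((1 : T) ⊗ₜ[k] x)
  rw [map_one, one_smul] at this
  rw [this, mulRightSnd_tmul]

theorem braidedMul_tmul_one_tmul (d : V ⊗[k] V ≃ₗ[k] V ⊗[k] V) (x : T) (Y : T ⊗[k] T) :
    braidedMul d ((x ⊗ₜ[k] 1) ⊗ₜ[k] Y) = mulLeftFst T x Y := by
  rw [braidedMul_tmul_left, map_one, Module.End.one_apply]

theorem braidedMul_one_tmul_tmul_one (d : V ⊗[k] V ≃ₗ[k] V ⊗[k] V) (x y : T) :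
    braidedMul d ((1 ⊗ₜ[k] x) ⊗ₜ[k] (y ⊗ₜ[k] 1)) = braiding d (x ⊗ₜ[k] y) := by
  rw [braidedMul_tmul, LinearMap.mulLeft_one, LinearMap.mulRight_one, TensorProduct.map_id,
    LinearMap.id_apply]

namespace IsLeftTriangular

variable {d : V ⊗[k] V ≃ₗ[k] V ⊗[k] V} {α : ι → ι → k} (hd : IsLeftTriangular b d α)
include hd

/-- In Δ(gh) the only term that is neither wanted nor harmless is `u ⊗ h`, since `u` is a beginning
of `u ++ v` and does not exceed it. The part `d (h ⊗ u)` of Δ(hg) is `s u ⊗ h` plus harmless terms,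
with `s` the braiding scalar of `v` and `u`, so the factor `s⁻¹` cancels it. The other left words
exceed `u ++ v`, often because `v` already does. -/
theorem isLyndonElement_append {u v : List ι} {g h : T} (hu : u ≠ []) (hv : Lyndon v)
    (huv : u < v) (hg : IsLyndonElement b d u g) (hh : IsLyndonElement b d v h) :
    IsLyndonElement b d (u ++ v) (g * h - (braidScalar α v u)⁻¹ • (h * g)) := by
  have hwv : Diverges (u ++ v) v := diverges_of_lt (hv.append_lt hu huv) (by simp)
  have hperm : (v ++ u).Perm (u ++ v) := List.perm_append_comm
  refine ⟨?_, ?_⟩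
  · have h1 := hg.leading.mul hh.leading
    have h2 : h * g ∈ wordSpan b {z | z.Perm (u ++ v) ∧ Diverges (u ++ v) z} := by
      rw [← sub_add_cancel (h * g) (wordElem b (v ++ u))]
      have hvu : Diverges (u ++ v) (v ++ u) := hwv.append_left u
      refine Submodule.add_mem _ (wordSpan_mono ?_ (hh.leading.mul hg.leading))
        (wordElem_mem ⟨hperm, hvu⟩)
      exact fun z hz => ⟨hz.1.trans hperm, hvu.trans hz.2⟩
    rw [HasLeadingWord, sub_right_comm]
    exact Submodule.sub_mem _ h1 (Submodule.smul_mem _ _ h2)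
  · have hεg := hg.comul
    have hεh := hh.comul
    have hΔg := hd.comul_mem_of_mem hg.leading.mem_length
    have hΔh := hd.comul_mem_of_mem hh.leading.mem_length
    have eg : BraidedPBW.comul d g = 1 ⊗ₜ[k] g + wordElem b u ⊗ₜ[k] 1 +
      (BraidedPBW.comul d g - 1 ⊗ₜ[k] g - wordElem b u ⊗ₜ[k] 1) := by abel
    have eh : BraidedPBW.comul d h = 1 ⊗ₜ[k] h + (wordElem b v ⊗ₜ[k] 1 +
      (BraidedPBW.comul d h - 1 ⊗ₜ[k] h - wordElem b v ⊗ₜ[k] 1)) := by abel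
    set εg := BraidedPBW.comul d g - 1 ⊗ₜ[k] g - wordElem b u ⊗ₜ[k] 1
    set εh := BraidedPBW.comul d h - 1 ⊗ₜ[k] h - wordElem b v ⊗ₜ[k] 1
    set Δg := BraidedPBW.comul d g
    set Δh := BraidedPBW.comul d h
    set s := braidScalar α v u with hs
    have hs0 : s ≠ 0 := hd.braidScalar_ne_zero v u
    set W := {p : List ι × List ι |
      Diverges (u ++ v) p.1 ∧ p.1.length + p.2.length = (u ++ v).length}
    have hεh' : wordElem b v ⊗ₜ[k] 1 + εh ∈
        pairSpan b {p | (p.1 = v ∨ Diverges v p.1) ∧ p.1.length + p.2.length = v.length} := by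
      refine Submodule.add_mem _ ?_ (pairSpan_mono ?_ hεh)
      · rw [← wordElem_nil b]
        exact tmul_mem_pairSpan ⟨.inl rfl, by simp⟩
      · exact fun p hp => ⟨.inr hp.1, hp.2⟩
    have hwz {z : List ι} (hz : z = v ∨ Diverges v z) : Diverges (u ++ v) z := by
      rcases hz with rfl | hz
      · exact hwv
      · exact hwv.trans hz
    -- The harmless parts: `m1`, `m2`, `m3` come from Δ(gh), and `m4`, `m5`, `m6` from Δ(hg).
    have m1 : braidedMul d ((1 ⊗ₜ[k] g) ⊗ₜ[k] (wordElem b v ⊗ₜ[k] 1 + εh)) ∈ pairSpan b W := by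
      refine hd.braidedMul_mem (one_tmul_mem_pairSpan hg.leading.mem_length
        (B := {p | p.1 = [] ∧ p.2.length = u.length}) fun t ht => ⟨rfl, ht⟩) hεh' ?_
      rintro x y z w z' y' ⟨rfl, hy⟩ ⟨hz, hl⟩ hr hy'
      refine ⟨Raises.trans_diverges hr (hwz hz), ?_⟩
      have := hr.2
      simp only [List.length_append, List.length_nil] at *
      omega
    have m2 : braidedMul d ((wordElem b u ⊗ₜ[k] 1) ⊗ₜ[k] εh) ∈ pairSpan b W := by
      rw [← wordElem_nil b]
      refine hd.braidedMul_mem (A := {p | p = (u, [])}) (tmul_mem_pairSpan rfl) hεh ?_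
      rintro x y z w z' y' ⟨rfl, rfl⟩ ⟨hz, hl⟩ hr hy'
      refine ⟨(hr.trans_diverges hz).prepend _, ?_⟩
      have := hr.2
      simp only [List.length_append, List.length_nil] at *
      omega
    have m3 : braidedMul d (εg ⊗ₜ[k] Δh) ∈ pairSpan b W := by
      refine hd.braidedMul_mem hεg hΔh ?_
      rintro x y z w z' y' ⟨hx, hl⟩ hz hr hy'
      refine ⟨hx.append _ _, ?_⟩
      have := hr.2
      simp only [Set.mem_ofPred_eq, List.length_append] at *
      omega
    have m4 : braiding d (h ⊗ₜ[k] wordElem b u) - s • (wordElem b u ⊗ₜ[k] h) ∈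
        pairSpan b W := by
      refine pairSpan_mono ?_ (hd.braiding_tmul_sub_mem hh.leading.mem u)
      exact fun p hp => ⟨by simpa using hp.1.append v [], by simp [hp.2]⟩
    have m5 : braidedMul d ((1 ⊗ₜ[k] h) ⊗ₜ[k] εg) ∈ pairSpan b W := by
      refine hd.braidedMul_mem (one_tmul_mem_pairSpan hh.leading.mem_length
        (B := {p | p.1 = [] ∧ p.2.length = v.length}) fun t ht => ⟨rfl, ht⟩) hεg ?_
      rintro x y z w z' y' ⟨rfl, hy⟩ ⟨hz, hl⟩ hr hy'
      refine ⟨by simpa using (hr.trans_diverges hz).append v [], ?_⟩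
      have := hr.2
      simp only [List.length_append, List.length_nil] at *
      omega
    have m6 : braidedMul d ((wordElem b v ⊗ₜ[k] 1 + εh) ⊗ₜ[k] Δg) ∈ pairSpan b W := by
      refine hd.braidedMul_mem hεh' hΔg ?_
      rintro x y z w z' y' ⟨hx, hl⟩ hz hr hy'
      refine ⟨(hwz hx).append_left _, ?_⟩
      have := hr.2
      simp only [Set.mem_ofPred_eq, List.length_append] at *
      omega
    have e1 : BraidedPBW.comul d (g * h) = 1 ⊗ₜ[k] (g * h) +
        braidedMul d ((1 ⊗ₜ[k] g) ⊗ₜ[k] (wordElem b v ⊗ₜ[k] 1 + εh)) +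
        (wordElem b u ⊗ₜ[k] h + wordElem b (u ++ v) ⊗ₜ[k] 1 +
          braidedMul d ((wordElem b u ⊗ₜ[k] 1) ⊗ₜ[k] εh)) +
        braidedMul d (εg ⊗ₜ[k] Δh) := by
      have f1 : braidedMul d ((1 ⊗ₜ[k] g) ⊗ₜ[k] Δh) = 1 ⊗ₜ[k] (g * h) +
          braidedMul d ((1 ⊗ₜ[k] g) ⊗ₜ[k] (wordElem b v ⊗ₜ[k] 1 + εh)) := by
        rw [eh, TensorProduct.tmul_add, map_add, braidedMul_one_tmul_one_tmul]
      have f2 : braidedMul d ((wordElem b u ⊗ₜ[k] 1) ⊗ₜ[k] Δh) =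
          wordElem b u ⊗ₜ[k] h + wordElem b (u ++ v) ⊗ₜ[k] 1 +
          braidedMul d ((wordElem b u ⊗ₜ[k] 1) ⊗ₜ[k] εh) := by
        rw [eh, TensorProduct.tmul_add, TensorProduct.tmul_add, map_add, map_add, ← add_assoc]
        congr 1
        rw [braidedMul_tmul_one_tmul, braidedMul_tmul_one_tmul]
        simp [wordElem_append]
      rw [comul_mul, ← f1, ← f2, ← map_add, ← map_add, ← TensorProduct.add_tmul,
        ← TensorProduct.add_tmul, ← eg]
    have e2 : BraidedPBW.comul d (h * g) = 1 ⊗ₜ[k] (h * g) +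
        braiding d (h ⊗ₜ[k] wordElem b u) + braidedMul d ((1 ⊗ₜ[k] h) ⊗ₜ[k] εg) +
        braidedMul d ((wordElem b v ⊗ₜ[k] 1 + εh) ⊗ₜ[k] Δg) := by
      have f1 : braidedMul d ((1 ⊗ₜ[k] h) ⊗ₜ[k] Δg) = 1 ⊗ₜ[k] (h * g) +
          braiding d (h ⊗ₜ[k] wordElem b u) + braidedMul d ((1 ⊗ₜ[k] h) ⊗ₜ[k] εg) := by
        rw [eg, TensorProduct.tmul_add, TensorProduct.tmul_add, map_add, map_add,
          braidedMul_one_tmul_one_tmul, braidedMul_one_tmul_tmul_one]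
      rw [comul_mul, ← f1, ← map_add, ← TensorProduct.add_tmul, ← eh]
    have total := Submodule.sub_mem _ (Submodule.add_mem _ (Submodule.add_mem _ m1 m2) m3)
      (Submodule.smul_mem _ s⁻¹ (Submodule.add_mem _ (Submodule.add_mem _ m4 m5) m6))
    have e3 : (1 : T) ⊗ₜ[k] (g * h - s⁻¹ • (h * g)) =
        1 ⊗ₜ[k] (g * h) - s⁻¹ • ((1 : T) ⊗ₜ[k] (h * g)) := by
      rw [TensorProduct.tmul_sub, TensorProduct.tmul_smul]
    convert total using 1
    rw [map_sub, map_smul, e1, e2, e3]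
    simp only [smul_add, smul_sub, smul_smul, inv_mul_cancel₀ hs0, one_smul]
    abel

theorem exists_isLyndonElement {w : List ι} (hw : Lyndon w) : ∃ g, IsLyndonElement b d w g := by
  induction hn : w.length using Nat.strong_induction_on generalizing w with
  | _ n ih =>
    by_cases hl : 2 ≤ w.length
    · obtain ⟨u, v, hu, hv, huv, rfl⟩ := hw.exists_factorization hl
      have hu1 := List.length_pos_iff.2 hu.1
      have hv1 := List.length_pos_iff.2 hv.1
      rw [List.length_append] at hn
      obtain ⟨g, hg⟩ := ih u.length (by omega) hu rfl
      obtain ⟨h, hh⟩ := ih v.length (by omega) hv rfl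
      exact ⟨_, hd.isLyndonElement_append hu.1 hv huv hg hh⟩
    · have := List.length_pos_iff.2 hw.1
      obtain ⟨x, rfl⟩ := List.length_eq_one_iff.1 (show w.length = 1 by omega)
      refine ⟨wordElem b [x], hasLeadingWord_self _, ?_⟩
      rw [wordElem_singleton, comul_ι]
      simp

end IsLeftTriangular

end LyndonElements

/-! ### Comultiplication of products of Lyndon elements -/

noncomputable section LyndonProducts

variable {k V ι : Type*} [Field k] [AddCommGroup V] [Module k V] [LinearOrder ι]

local notation "T" => TensorAlgebra k V

variable {b : Module.Basis ι k V}

theorem HasLeadingWord.pow {v : List ι} {g : T} (h : HasLeadingWord b v g) (n : ℕ) :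
    HasLeadingWord b (rep v n) (g ^ n) := by
  induction n with
  | zero => simpa using hasLeadingWord_self (b := b) []
  | succ n ih => rw [rep_succ, pow_succ']; exact h.mul ih

/-- The product of powers of `G v` in which `v` runs through a list of words, the first entry of
the list giving the last factor. -/
def lyndonProd (G : List ι → T) : List (List ι × ℕ) → T
  | [] => 1
  | x :: q => lyndonProd G q * G x.1 ^ x.2

variable (b) in
/-- The span of all `z ⊗ t` of total length `n` for which `z` exceeds a power of `v`, or is
`v ^ j` with `j < s`. -/
def powerSpan (v : List ι) (s n : ℕ) : Submodule k (T ⊗[k] T) :=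
  pairSpan b {p | (PowerDiverges v p.1 ∨ ∃ j < s, p.1 = rep v j) ∧
    p.1.length + p.2.length = n}

variable (b) in
/-- `x` is homogeneous of degree `n`, and `Δ x ∈ 1 ⊗ x + ∑ z ⊗ T(V)`, with words `z` that exceed a
power of `v`. -/
def IsRightPrimitiveAbove (d : V ⊗[k] V ≃ₗ[k] V ⊗[k] V) (v : List ι) (n : ℕ) (x : T) : Prop :=
  x ∈ wordSpan b {z | z.length = n} ∧ comul d x - 1 ⊗ₜ[k] x ∈ powerSpan b v 0 n

theorem powerSpan_mono {v : List ι} {s s' n : ℕ} (h : s ≤ s') :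
    powerSpan b v s n ≤ powerSpan b v s' n :=
  pairSpan_mono fun _ hp => ⟨hp.1.imp_right fun ⟨j, hj, e⟩ => ⟨j, hj.trans_le h, e⟩, hp.2⟩

theorem isRightPrimitiveAbove_one (d : V ⊗[k] V ≃ₗ[k] V ⊗[k] V) (v : List ι) :
    IsRightPrimitiveAbove b d v 0 1 := by
  refine ⟨?_, by simp [comul_one]⟩
  rw [← wordElem_nil b]
  exact wordElem_mem rfl

namespace IsLeftTriangular

variable {d : V ⊗[k] V ≃ₗ[k] V ⊗[k] V} {α : ι → ι → k} (hd : IsLeftTriangular b d α)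
include hd

theorem one_tmul_mul_mem_powerSpan {v : List ι} {s m n : ℕ} {x : T} {Y : T ⊗[k] T}
    (hx : x ∈ wordSpan b {z | z.length = m}) (hY : Y ∈ powerSpan b v s n) :
    braidedMul d ((1 ⊗ₜ[k] x) ⊗ₜ[k] Y) ∈ powerSpan b v s (m + n) := by
  refine hd.braidedMul_mem (one_tmul_mem_pairSpan hx
    (B := {p | p.1 = [] ∧ p.2.length = m}) fun t ht => ⟨rfl, ht⟩) hY ?_
  rintro x y z w z' y' ⟨rfl, hy⟩ ⟨hz, hl⟩ hr hy'
  have := hr.2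
  refine ⟨?_, by simp only [List.length_append, List.length_nil] at *; omega⟩
  simp only [List.nil_append] at *
  rcases hr.1 with rfl | hd
  · exact hz
  · rcases hz with hz | ⟨j, -, rfl⟩
    · exact .inl (hz.trans hd)
    · exact .inl ⟨j, hd⟩

theorem mul_mem_powerSpan_zero {v : List ι} {m n : ℕ} {X Y : T ⊗[k] T}
    (hX : X ∈ powerSpan b v 0 m)
    (hY : Y ∈ pairSpan b {p | p.1.length + p.2.length = n}) :
    braidedMul d (X ⊗ₜ[k] Y) ∈ powerSpan b v 0 (m + n) := by
  refine hd.braidedMul_mem hX hY ?_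
  rintro x y z w z' y' ⟨hx, hl⟩ hz hr hy'
  have := hr.2
  refine ⟨?_, by simp only [Set.mem_ofPred_eq, List.length_append] at *; omega⟩
  rcases hx with hx | ⟨j, hj, -⟩
  · exact .inl (hx.append _)
  · omega

theorem isRightPrimitiveAbove_mul {v : List ι} {m n : ℕ} {x y : T}
    (hx : IsRightPrimitiveAbove b d v m x) (hy : IsRightPrimitiveAbove b d v n y) :
    IsRightPrimitiveAbove b d v (m + n) (x * y) := by
  refine ⟨mul_mem_wordSpan hx.1 hy.1 fun u w hu hw => ?_, ?_⟩
  · simp only [Set.mem_ofPred_eq, List.length_append] at *; omega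
  · have h1 := hd.one_tmul_mul_mem_powerSpan hx.1 hy.2
    have h2 := hd.mul_mem_powerSpan_zero hx.2 (hd.comul_mem_of_mem hy.1)
    convert Submodule.add_mem _ h1 h2 using 1
    rw [comul_mul, TensorProduct.tmul_sub, TensorProduct.sub_tmul, map_sub, map_sub,
      braidedMul_one_tmul_one_tmul]
    abel

theorem isRightPrimitiveAbove_pow {v : List ι} {m : ℕ} {x : T}
    (hx : IsRightPrimitiveAbove b d v m x) (n : ℕ) :
    IsRightPrimitiveAbove b d v (n * m) (x ^ n) := by
  induction n with
  | zero => simpa using isRightPrimitiveAbove_one d v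
  | succ n ih => rw [pow_succ, Nat.succ_mul]; exact hd.isRightPrimitiveAbove_mul ih hx

omit hd in
-- Seen from a smaller Lyndon word `v`, the term `w ⊗ 1` is no exception: `w` itself exceeds a power
-- of `v`.
theorem isRightPrimitiveAbove_of_lt {v w : List ι} {g : T} (hv : Lyndon v) (hw : Lyndon w)
    (hvw : v < w) (hg : IsLyndonElement b d w g) :
    IsRightPrimitiveAbove b d v w.length g := by
  refine ⟨hg.leading.mem_length, ?_⟩
  rw [← sub_add_cancel (BraidedPBW.comul d g - 1 ⊗ₜ[k] g) (wordElem b w ⊗ₜ[k] 1)]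
  have h := hv.powerDiverges hw hvw
  refine Submodule.add_mem _ (pairSpan_mono ?_ hg.comul) ?_
  · exact fun p hp => ⟨.inl (h.trans hp.1), hp.2⟩
  · rw [← wordElem_nil b]
    exact tmul_mem_pairSpan ⟨.inl h, by simp⟩

theorem isRightPrimitiveAbove_lyndonProd {G : List ι → T}
    (hG : ∀ w, Lyndon w → IsLyndonElement b d w (G w)) {v : List ι} (hv : Lyndon v)
    {q : List (List ι × ℕ)} (hq : ∀ x ∈ q, Lyndon x.1 ∧ v < x.1) :
    IsRightPrimitiveAbove b d v (powerWord q).length (lyndonProd G q) := by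
  induction q with
  | nil => exact isRightPrimitiveAbove_one d v
  | cons x q ih =>
    obtain ⟨hx, hvx⟩ := hq x (by simp)
    rw [powerWord, List.length_append, length_rep]
    exact hd.isRightPrimitiveAbove_mul (ih fun y hy => hq y (List.mem_cons_of_mem _ hy))
      (hd.isRightPrimitiveAbove_pow (isRightPrimitiveAbove_of_lt hv hx hvx (hG _ hx)) _)

/-- Only the factor `v ⊗ 1` of Δ(g) can lengthen a left word `v ^ j` to `v ^ (j + 1)`. Hence the
full power arises solely from choosing this summand every time. -/
theorem comul_pow_sub_mem {v : List ι} {g : T} (hg : IsLyndonElement b d v g) (s : ℕ) :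
    comul d (g ^ s) - wordElem b (rep v s) ⊗ₜ[k] 1 ∈ powerSpan b v s (s * v.length) := by
  induction s with
  | zero => simp [comul_one]
  | succ s ih =>
    have hv0 : v.length + s * v.length = (s + 1) * v.length := by ring
    have hΔ : BraidedPBW.comul d (g ^ s) ∈ powerSpan b v (s + 1) (s * v.length) := by
      rw [← sub_add_cancel (BraidedPBW.comul d (g ^ s)) (wordElem b (rep v s) ⊗ₜ[k] 1)]
      refine Submodule.add_mem _ (powerSpan_mono s.le_succ ih) ?_
      rw [← wordElem_nil b]
      exact tmul_mem_pairSpan ⟨.inr ⟨s, s.lt_succ_self, rfl⟩, by simp⟩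
    have m1 := hd.one_tmul_mul_mem_powerSpan hg.leading.mem_length hΔ
    have hε : BraidedPBW.comul d g - 1 ⊗ₜ[k] g - wordElem b v ⊗ₜ[k] 1 ∈
        powerSpan b v 0 v.length := by
      refine pairSpan_mono ?_ hg.comul
      exact fun p hp => ⟨.inl ⟨1, by simpa using hp.1⟩, hp.2⟩
    have m2 := powerSpan_mono (Nat.zero_le (s + 1)) (hd.mul_mem_powerSpan_zero hε
      (hd.comul_mem_of_mem (hg.leading.pow s).mem_length))
    rw [length_rep] at m2
    have m3 : braidedMul d ((wordElem b v ⊗ₜ[k] 1) ⊗ₜ[k]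
        (BraidedPBW.comul d (g ^ s) - wordElem b (rep v s) ⊗ₜ[k] 1)) ∈
        powerSpan b v (s + 1) (v.length + s * v.length) := by
      rw [← wordElem_nil b] at ih ⊢
      refine hd.braidedMul_mem (A := {p | p = (v, [])}) (tmul_mem_pairSpan rfl) ih ?_
      rintro x y z w z' y' ⟨rfl, rfl⟩ ⟨hz, hl⟩ hr hy'
      have := hr.2
      refine ⟨?_, by simp only [List.length_append, List.length_nil] at *; omega⟩
      have hpre {z : List ι} (h : PowerDiverges v z) : PowerDiverges v (v ++ z) := by
        simpa using h.prepend 1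
      rcases hr.1 with rfl | hd
      · rcases hz with hz | ⟨j, hj, rfl⟩
        · exact .inl (hpre hz)
        · exact .inr ⟨j + 1, by omega, rfl⟩
      · rcases hz with hz | ⟨j, -, rfl⟩
        · exact .inl (hpre (hz.trans hd))
        · exact .inl (hpre ⟨j, hd⟩)
    rw [← hv0]
    convert Submodule.add_mem _ (Submodule.add_mem _ m1 m2) m3 using 1
    have e : braidedMul d ((wordElem b v ⊗ₜ[k] 1) ⊗ₜ[k] (wordElem b (rep v s) ⊗ₜ[k] 1)) =
        wordElem b (rep v (s + 1)) ⊗ₜ[k] 1 := by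
      rw [braidedMul_tmul_one_tmul, mulLeftFst_tmul, rep_succ, wordElem_append]
    rw [pow_succ', comul_mul, TensorProduct.sub_tmul, TensorProduct.sub_tmul, map_sub, map_sub,
      TensorProduct.tmul_sub, map_sub, e]
    abel

/-- The leading term arises when `1 ⊗ x` meets `v ^ s ⊗ 1`, where the braiding contributes the
scalar. -/
theorem comul_mul_pow_sub_mem {v t : List ι} {g x : T} (hg : IsLyndonElement b d v g)
    (hxt : x ∈ wordSpan b {u | u.Perm t}) (hx : IsRightPrimitiveAbove b d v t.length x) (s : ℕ) :
    comul d (x * g ^ s) - braidScalar α t (rep v s) • (wordElem b (rep v s) ⊗ₜ[k] x) ∈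
      powerSpan b v s (t.length + s * v.length) := by
  have m1 := hd.one_tmul_mul_mem_powerSpan hx.1 (hd.comul_pow_sub_mem hg s)
  have m2 := powerSpan_mono (Nat.zero_le s) (hd.mul_mem_powerSpan_zero hx.2
    (hd.comul_mem_of_mem (hg.leading.pow s).mem_length))
  rw [length_rep] at m2
  have m3 : braiding d (x ⊗ₜ[k] wordElem b (rep v s)) -
      braidScalar α t (rep v s) • (wordElem b (rep v s) ⊗ₜ[k] x) ∈
      powerSpan b v s (t.length + s * v.length) := by
    refine pairSpan_mono ?_ (hd.braiding_tmul_sub_mem hxt (rep v s))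
    exact fun p hp => ⟨.inl ⟨s, hp.1⟩, by rw [hp.2.1, hp.2.2, length_rep, add_comm]⟩
  convert Submodule.add_mem _ (Submodule.add_mem _ m1 m2) m3 using 1
  rw [comul_mul, TensorProduct.sub_tmul, TensorProduct.tmul_sub, map_sub, map_sub,
    braidedMul_one_tmul_tmul_one]
  abel

end IsLeftTriangular

theorem hasLeadingWord_lyndonProd {d : V ⊗[k] V ≃ₗ[k] V ⊗[k] V} {G : List ι → T}
    (hG : ∀ w, Lyndon w → IsLyndonElement b d w (G w))
    {q : List (List ι × ℕ)} (hq : LyndonList q) :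
    HasLeadingWord b (powerWord q) (lyndonProd G q) := by
  induction q with
  | nil => simpa [powerWord, lyndonProd] using hasLeadingWord_self (b := b) []
  | cons x q ih => exact (ih hq.tail).mul ((hG _ (hq.2 x (by simp)).1).leading.pow _)

/-- The contraction of the left tensor factor with a linear form. -/
def contractLeft (f : T →ₗ[k] k) : T ⊗[k] T →ₗ[k] T :=
  (TensorProduct.lid k T).toLinearMap ∘ₗ f.rTensor T

@[simp] theorem contractLeft_tmul (f : T →ₗ[k] k) (x y : T) :
    contractLeft f (x ⊗ₜ[k] y) = f x • y := by
  simp [contractLeft]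

theorem contractLeft_mem {f : T →ₗ[k] k} {J : Submodule k T} (hf : ∀ x ∈ J, f x = 0)
    {X : T ⊗[k] T} (hX : X ∈ sumTensor J) : contractLeft f X ∈ J := by
  have hl (Y : T ⊗[k] J) : contractLeft f (J.subtype.lTensor T Y) ∈ J := by
    induction Y using TensorProduct.induction_on with
    | zero => simp
    | tmul x y => simpa using J.smul_mem _ y.2
    | add x y hx hy => simpa only [map_add] using J.add_mem hx hy
  have hr (Z : J ⊗[k] T) : contractLeft f (J.subtype.rTensor T Z) ∈ J := by
    induction Z using TensorProduct.induction_on with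
    | zero => simp
    | tmul x y => simp [hf x x.2]
    | add x y hx hy => simpa only [map_add] using J.add_mem hx hy
  obtain ⟨_, ⟨Y, rfl⟩, _, ⟨Z, rfl⟩, rfl⟩ := Submodule.mem_sup.1 hX
  rw [map_add]
  exact J.add_mem (hl Y) (hr Z)

end LyndonProducts

/-! ### Independence of products of normal powers -/

noncomputable section Independence

variable {k V ι : Type*} [Field k] [AddCommGroup V] [Module k V] [LinearOrder ι]

local notation "T" => TensorAlgebra k V

/-- The words that cannot be written modulo `J` in terms of larger words. -/
def IsNormalWord (b : Module.Basis ι k V) (J : Submodule k T) (w : List ι) : Prop :=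
  wordElem b w ∉ spanAbove b (FreeMonoid.ofList w) ⊔ J

/-- Strictly increasing lists of powers of Lyndon words, where the powers are normal words. -/
def IsNormalList (b : Module.Basis ι k V) (J : Submodule k T) (q : List (List ι × ℕ)) : Prop :=
  LyndonList q ∧ ∀ x ∈ q, IsNormalWord b J (rep x.1 x.2)

variable {b : Module.Basis ι k V} {J : Submodule k (TensorAlgebra k V)}

theorem spanAbove_eq_wordSpan (b : Module.Basis ι k V) (w : List ι) :
    spanAbove b (FreeMonoid.ofList w) =
      wordSpan b {z | z.length < w.length ∨ z.length = w.length ∧ w < z} := rfl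

theorem IsNormalList.tail {x : List ι × ℕ} {q : List (List ι × ℕ)}
    (h : IsNormalList b J (x :: q)) : IsNormalList b J q :=
  ⟨h.1.tail, fun y hy => h.2 y (List.mem_cons_of_mem _ hy)⟩

theorem contractLeft_mem_of_length {f : T →ₗ[k] k} {p m n : ℕ} (hn : n < p + m)
    (hf : ∀ z : List ι, z.length < p → f (wordElem b z) = 0) {X : T ⊗[k] T}
    (hX : X ∈ pairSpan b {p | p.1.length + p.2.length = n}) :
    contractLeft f X ∈ wordSpan b {t | t.length < m} := by
  refine map_mem_of_pairSpan (contractLeft f) hX fun z t (h : z.length + t.length = n) => ?_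
  rw [contractLeft_tmul]
  by_cases hz : z.length < p
  · rw [hf z hz, zero_smul]; exact Submodule.zero_mem _
  · exact Submodule.smul_mem _ _ (wordElem_mem (show t.length < m by omega))

/-- A left word shorter than `v ^ r` is killed by `f`, and a longer one leaves a short right word.
At equal length it is not `v ^ j` with `j < r`, so it exceeds `v ^ r` and is killed too. -/
theorem contractLeft_mem_of_powerSpan {f : T →ₗ[k] k} {v : List ι} {r m n : ℕ}
    (hv : v ≠ []) (hn : n = r * v.length + m)
    (hf : ∀ z : List ι, z.length < r * v.length → f (wordElem b z) = 0)
    (hf' : ∀ z : List ι, z.length = r * v.length → Diverges (rep v r) z →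
      f (wordElem b z) = 0) {X : T ⊗[k] T} (hX : X ∈ powerSpan b v r n) :
    contractLeft f X ∈ wordSpan b {t | t.length < m} := by
  refine map_mem_of_pairSpan (contractLeft f) hX ?_
  rintro z t ⟨hz, hl⟩
  simp only at hz hl
  rw [contractLeft_tmul]
  rcases lt_trichotomy z.length (r * v.length) with h | h | h
  · rw [hf z h, zero_smul]; exact Submodule.zero_mem _
  · rcases hz with hz | ⟨j, hj, rfl⟩
    · rw [hf' z h (hz.diverges h.le), zero_smul]; exact Submodule.zero_mem _
    · rw [length_rep] at h
      exact absurd (Nat.eq_of_mul_eq_mul_right (List.length_pos_iff.2 hv) h) hj.ne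
  · exact Submodule.smul_mem _ _ (wordElem_mem (show t.length < m by omega))

theorem LyndonList.length_pos {x : List ι × ℕ} {q : List (List ι × ℕ)}
    (h : LyndonList (x :: q)) : 0 < x.2 * x.1.length :=
  Nat.mul_pos (h.2 x (by simp)).2 (List.length_pos_iff.2 (h.2 x (by simp)).1.1)

theorem length_powerWord_cons (x : List ι × ℕ) (q : List (List ι × ℕ)) :
    (powerWord (x :: q)).length = (powerWord q).length + x.2 * x.1.length := by
  simp [powerWord]

/-- If `(v, r)` is the head of a list with smallest `v`, and then largest `r`, the contraction of
`Δ` with a linear form that detects `v ^ r` isolates the lists with head `(v, r)`. -/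
theorem contractLeft_comul_lyndonProd {d : V ⊗[k] V ≃ₗ[k] V ⊗[k] V} {α : ι → ι → k}
    (hd : IsLeftTriangular b d α) {G : List ι → T}
    (hG : ∀ w, Lyndon w → IsLyndonElement b d w (G w)) {v : List ι} (hv : Lyndon v) {r m : ℕ}
    (hr : 0 < r) {f : T →ₗ[k] k}
    (hf : ∀ z : List ι, z.length < r * v.length → f (wordElem b z) = 0)
    (hf' : ∀ z : List ι, z.length = r * v.length → Diverges (rep v r) z →
      f (wordElem b z) = 0)
    {x : List ι × ℕ} {q : List (List ι × ℕ)} (hq : LyndonList (x :: q))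
    (hl : (powerWord (x :: q)).length = r * v.length + m)
    (hx : v < x.1 ∨ v = x.1 ∧ x.2 ≤ r) :
    contractLeft f (comul d (lyndonProd G (x :: q))) -
      (if x = (v, r) then (braidScalar α (powerWord q) (rep v r) * f (wordElem b (rep v r))) •
        lyndonProd G q else 0) ∈ wordSpan b {t | t.length < m} := by
  rcases hx with hx | ⟨rfl, hxr⟩
  -- All factors belong to words larger than `v`, so Δ has no term with left word `v ^ r`.
  · rw [if_neg (by rintro rfl; exact lt_irrefl _ hx), sub_zero]
    have hprim := hd.isRightPrimitiveAbove_lyndonProd hG hv (q := x :: q) fun y hy =>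
      ⟨(hq.2 y hy).1, by
        rcases List.mem_cons.1 hy with rfl | hy
        · exact hx
        · exact hx.trans ((List.pairwise_cons.1 hq.1).1 y hy)⟩
    have h1 := contractLeft_mem_of_powerSpan hv.1 hl hf hf'
      (powerSpan_mono (Nat.zero_le r) hprim.2)
    rw [map_sub, contractLeft_tmul] at h1
    have h2 : f 1 = 0 := by
      rw [← wordElem_nil b]
      exact hf [] (Nat.mul_pos hr (List.length_pos_iff.2 hv.1))
    rwa [h2, zero_smul, sub_zero] at h1
  -- For `s < r` the leading left word `v ^ s` is too short for `f` to detect; only `s = r`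
  -- survives.
  · obtain ⟨v, s⟩ := x
    have hprim := hd.isRightPrimitiveAbove_lyndonProd hG hv (q := q) fun y hy =>
      ⟨(hq.tail.2 y hy).1, (List.pairwise_cons.1 hq.1).1 y hy⟩
    have h1 := contractLeft_mem_of_powerSpan hv.1 hl hf hf' (by
      rw [length_powerWord_cons]
      exact powerSpan_mono hxr (hd.comul_mul_pow_sub_mem (hG v hv)
        (hasLeadingWord_lyndonProd hG hq.tail).mem hprim s))
    rw [map_sub, map_smul, contractLeft_tmul] at h1
    rcases hxr.lt_or_eq with hlt | heq
    · have h2 : f (wordElem b (rep v s)) = 0 :=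
        hf _ (by rw [length_rep]; exact Nat.mul_lt_mul_of_pos_right hlt (List.length_pos_iff.2 hv.1))
      rw [h2, zero_smul, smul_zero, sub_zero] at h1
      rw [if_neg (fun h => hlt.ne (Prod.mk.inj h).2), sub_zero]
      exact h1
    · simp only at heq
      subst heq
      rw [if_pos rfl, mul_smul]
      exact h1

/-- Products of Lyndon elements given by lists of normal powers are linearly independent
modulo `J` and terms of smaller degree. -/
theorem lyndonProd_independent {d : V ⊗[k] V ≃ₗ[k] V ⊗[k] V} {α : ι → ι → k}
    (hd : IsLeftTriangular b d α) {G : List ι → T}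
    (hG : ∀ w, Lyndon w → IsLyndonElement b d w (G w))
    (hJ : ∀ x ∈ J, comul d x ∈ sumTensor J) (h1 : (1 : T) ∉ J) (n : ℕ)
    (Q : Finset (List (List ι × ℕ))) (a : List (List ι × ℕ) → k)
    (hQ : ∀ q ∈ Q, IsNormalList b J q ∧ (powerWord q).length = n)
    (hsum : ∑ q ∈ Q, a q • lyndonProd G q ∈ wordSpan b {t | t.length < n} ⊔ J) :
    ∀ q ∈ Q, a q = 0 := by
  classical
  induction n using Nat.strong_induction_on generalizing Q a with
  | _ n ih =>
    by_contra! hne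
    obtain ⟨q₁, hq₁, ha₁⟩ := hne
    obtain ⟨Q', hQ'⟩ : ∃ Q', Q' = Q.filter fun q => a q ≠ 0 := ⟨_, rfl⟩
    have hmem (q) : q ∈ Q' ↔ q ∈ Q ∧ a q ≠ 0 := by rw [hQ', Finset.mem_filter]
    rw [← Finset.sum_filter_of_ne (p := fun q => a q ≠ 0)
      (fun q _ h h0 => h (by rw [h0, zero_smul])), ← hQ'] at hsum
    -- The order dual selects the largest exponent among the smallest words. Empty lists occur only
    -- in degree zero, so the default value never competes with a genuine head.
    obtain ⟨q₀, hq₀, hmin⟩ := Q'.exists_min_image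
      (fun q => (toLex ((q.headD ([], 0)).1, OrderDual.toDual (q.headD ([], 0)).2) :
        Lex (List ι × ℕᵒᵈ))) ⟨q₁, (hmem q₁).2 ⟨hq₁, ha₁⟩⟩
    cases q₀ with
    | nil =>
      have hn : n = 0 := ((hQ _ ((hmem _).1 hq₀).1).2).symm
      subst hn
      have hnil (q) (hq : q ∈ Q') : q = [] := by
        cases q with
        | nil => rfl
        | cons x q =>
          have h := hQ _ ((hmem _).1 hq).1
          have := h.1.1.length_pos
          have := h.2
          rw [length_powerWord_cons] at this
          omega
      rw [Finset.eq_singleton_iff_unique_mem.2 ⟨hq₀, hnil⟩, Finset.sum_singleton] at hsum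
      have h0 : wordSpan b {t | t.length < 0} = ⊥ := by simp [wordSpan]
      rw [h0, bot_sup_eq] at hsum
      exact h1 ((J.smul_mem_iff ((hmem _).1 hq₀).2).1 hsum)
    | cons x₀ q₀ =>
      obtain ⟨v, r⟩ := x₀
      obtain ⟨hnorm, hlen⟩ := hQ _ ((hmem _).1 hq₀).1
      obtain ⟨hv, hr⟩ := hnorm.1.2 (v, r) (by simp)
      simp only at hv hr
      -- Normality of `v ^ r` is exactly what provides this linear form.
      obtain ⟨f, hf0, hf⟩ := Submodule.exists_le_ker_of_notMem (hnorm.2 (v, r) (by simp))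
      have hfJ (x) (hx : x ∈ J) : f x = 0 := hf (Submodule.mem_sup_right hx)
      rw [spanAbove_eq_wordSpan, length_rep] at hf
      have hfl (z : List ι) (hz : z.length < r * v.length) : f (wordElem b z) = 0 :=
        hf (Submodule.mem_sup_left (wordElem_mem (.inl hz)))
      have hfl' (z : List ι) (hz : z.length = r * v.length) (hz' : Diverges (rep v r) z) :
          f (wordElem b z) = 0 :=
        hf (Submodule.mem_sup_left (wordElem_mem (.inr ⟨hz, hz'.lt⟩)))
      obtain ⟨m, hm⟩ : ∃ m, m = (powerWord q₀).length := ⟨_, rfl⟩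
      have hnm : n = r * v.length + m := by
        rw [← hlen, length_powerWord_cons, hm, add_comm]
      have hpos := hnorm.1.length_pos
      have hmn : m < n := by rw [hnm]; simp only at hpos; omega
      let F : T →ₗ[k] T := contractLeft f ∘ₗ comul d
      have hF : F (∑ q ∈ Q', a q • lyndonProd G q) ∈ wordSpan b {t | t.length < m} ⊔ J := by
        obtain ⟨y, hy, z, hz, e⟩ := Submodule.mem_sup.1 hsum
        rw [← e, map_add]
        refine Submodule.add_mem_sup ?_ (contractLeft_mem hfJ (hJ z hz))
        refine map_mem_of_wordSpan F hy fun u (hu : u.length < n) => ?_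
        exact contractLeft_mem_of_length (hnm ▸ hu) hfl (hd.comul_mem u)
      let g (q : List (List ι × ℕ)) : T := if q.head? = some (v, r) then
        (braidScalar α (powerWord q.tail) (rep v r) * f (wordElem b (rep v r))) •
          lyndonProd G q.tail else 0
      have hterm (q) (hq : q ∈ Q') :
          F (a q • lyndonProd G q) - a q • g q ∈ wordSpan b {t | t.length < m} ⊔ J := by
        rw [map_smul, ← smul_sub]
        refine Submodule.smul_mem _ _ (Submodule.mem_sup_left ?_)
        obtain ⟨hqn, hql⟩ := hQ _ ((hmem _).1 hq).1
        cases q with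
        | nil => simp [powerWord] at hql; omega
        | cons x q =>
          have hle := hmin _ hq
          simp only [List.headD_cons, Prod.Lex.toLex_le_toLex, OrderDual.toDual_le_toDual] at hle
          have := contractLeft_comul_lyndonProd hd hG hv hr hfl hfl' hqn.1 (hql.trans hnm) hle
          simpa [F, g] using this
      have hsum' : ∑ q ∈ Q', a q • g q ∈ wordSpan b {t | t.length < m} ⊔ J := by
        have := Submodule.sub_mem _ hF (Submodule.sum_mem _ hterm)
        rwa [map_sum, Finset.sum_sub_distrib, sub_sub_cancel] at this
      let R := (Q'.filter fun q => q.head? = some (v, r))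
      have hR (q) (hq : q ∈ R) : q ∈ Q' ∧ q = (v, r) :: q.tail := by
        obtain ⟨h1, h2⟩ := Finset.mem_filter.1 hq
        refine ⟨h1, ?_⟩
        cases q with
        | nil => simp at h2
        | cons x q => simp at h2; simp [h2]
      have hinj : Set.InjOn List.tail (R : Set (List (List ι × ℕ))) := fun q hq q' hq' h => by
        rw [(hR q hq).2, (hR q' hq').2, h]
      -- The tails of the lists with head `(v, r)` satisfy a relation of degree `m`. Its
      -- coefficients differ from the old ones by nonzero scalars.
      have key := ih m hmn (R.image List.tail)
        (fun q => a ((v, r) :: q) *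
          (braidScalar α (powerWord q) (rep v r) * f (wordElem b (rep v r)))) ?_ ?_ q₀
        (Finset.mem_image.2 ⟨_, Finset.mem_filter.2 ⟨hq₀, rfl⟩, rfl⟩)
      · exact mul_ne_zero ((hmem _).1 hq₀).2
          (mul_ne_zero (hd.braidScalar_ne_zero _ _) hf0) key
      · intro q hq
        obtain ⟨q', hq', rfl⟩ := Finset.mem_image.1 hq
        obtain ⟨h2, h3⟩ := hR q' hq'
        have h4 := hQ _ ((hmem _).1 h2).1
        rw [h3] at h4
        refine ⟨h4.1.tail, ?_⟩
        have := h4.2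
        rw [length_powerWord_cons] at this
        simp only at this
        omega
      · rw [Finset.sum_image hinj]
        convert hsum' using 1
        have := Finset.sum_filter_of_ne (s := Q') (f := fun q => a q • g q)
          (p := fun q => q.head? = some (v, r)) (fun q _ h => by
            by_contra h'
            exact h (by simp [g, h']))
        rw [← this]
        refine Finset.sum_congr rfl fun q hq => ?_
        rw [← (hR q hq).2, mul_smul]
        simp [g, (Finset.mem_filter.1 hq).2]

end Independence

/-! ### Normal words and lists of normal powers -/

noncomputable section NormalWords

set_option linter.unusedSectionVars false

variable {k V ι : Type*} [Field k] [AddCommGroup V] [Module k V] [LinearOrder ι]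

local notation "T" => TensorAlgebra k V

/-- The word `z` is larger than `w` in the standard order. -/
def Above (w z : List ι) : Prop := z.length < w.length ∨ z.length = w.length ∧ w < z

theorem Above.trans {u v w : List ι} (h : Above u v) (h' : Above v w) : Above u w := by
  rcases h with h | ⟨h, hl⟩ <;> rcases h' with h' | ⟨h', hl'⟩
  · exact .inl (h'.trans h)
  · exact .inl (h' ▸ h)
  · exact .inl (h ▸ h')
  · exact .inr ⟨h'.trans h, hl.trans hl'⟩

theorem not_above_self (w : List ι) : ¬Above w w := by
  rintro (h | ⟨-, h⟩) <;> exact lt_irrefl _ h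

theorem Above.append {w z : List ι} (h : Above w z) (p s : List ι) :
    Above (p ++ w ++ s) (p ++ z ++ s) := by
  rcases h with h | ⟨h, hl⟩
  · left; simp only [List.length_append]; omega
  · right
    refine ⟨by simp only [List.length_append]; omega, ?_⟩
    exact (((diverges_of_lt hl h.le).prepend p).append s s).lt

theorem above_of_diverges {w z : List ι} (h : Diverges w z) (hl : z.length = w.length) :
    Above w z := .inr ⟨hl, h.lt⟩

/-- A larger word is no longer than the given one, so over a finite alphabet only finitely many
exist. -/
theorem above_induction [Finite ι] {P : List ι → Prop}
    (h : ∀ w, (∀ z, Above w z → P z) → P w) (w : List ι) : P w := by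
  have hfin (w : List ι) : {z | Above w z}.Finite :=
    (List.finite_length_le ι w.length).subset fun z hz => hz.elim (fun h => h.le) fun h => h.1.le
  induction hn : {z | Above w z}.ncard using Nat.strong_induction_on generalizing w with
  | _ n ih =>
    refine h w fun z hz => ih _ ?_ z rfl
    rw [← hn]
    refine Set.ncard_lt_ncard ⟨fun y hy => hz.trans hy, fun hsub => ?_⟩ (hfin w)
    exact not_above_self z (hsub hz)

variable {b : Module.Basis ι k V} {J : Submodule k (TensorAlgebra k V)}

theorem isNormalWord_iff {w : List ι} :
    IsNormalWord b J w ↔ wordElem b w ∉ wordSpan b {z | Above w z} ⊔ J := Iff.rfl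

/-- The standard order is compatible with multiplication on both sides and `J` is an ideal, so
rewriting a factor rewrites the whole word. -/
theorem IsNormalWord.of_append (hl : ∀ x, ∀ y ∈ J, x * y ∈ J) (hr : ∀ x, ∀ y ∈ J, y * x ∈ J)
    {p w s : List ι} (h : IsNormalWord b J (p ++ w ++ s)) : IsNormalWord b J w := by
  rw [isNormalWord_iff] at *
  contrapose! h
  obtain ⟨x, hx, y, hy, e⟩ := Submodule.mem_sup.1 h
  rw [wordElem_append, wordElem_append, ← e, mul_add, add_mul]
  refine Submodule.add_mem_sup ?_ (hr _ _ (hl _ _ hy))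
  refine mul_mem_wordSpan (mul_mem_wordSpan (wordElem_mem (Set.mem_singleton p)) hx
    (C := {z | ∃ t, Above w t ∧ z = p ++ t}) ?_) (wordElem_mem (Set.mem_singleton s)) ?_
  · rintro u v rfl hv
    exact ⟨v, hv, rfl⟩
  · rintro _ v ⟨t, ht, rfl⟩ rfl
    exact ht.append p v

theorem IsNormalWord.of_rep (hl : ∀ x, ∀ y ∈ J, x * y ∈ J) (hr : ∀ x, ∀ y ∈ J, y * x ∈ J)
    {v : List ι} {m n : ℕ} (hmn : m ≤ n) (h : IsNormalWord b J (rep v n)) :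
    IsNormalWord b J (rep v m) := by
  obtain ⟨j, rfl⟩ := Nat.exists_eq_add_of_le hmn
  rw [rep_add] at h
  exact IsNormalWord.of_append hl hr (p := []) h

theorem sup_mono_of_wordSpan {A : Set (List ι)} {P : Submodule k T} {x : T}
    (hx : x ∈ wordSpan b A ⊔ J) (h : ∀ u ∈ A, wordElem b u ∈ P ⊔ J) : x ∈ P ⊔ J := by
  obtain ⟨y, hy, z, hz, rfl⟩ := Submodule.mem_sup.1 hx
  exact Submodule.add_mem _ (map_mem_of_wordSpan LinearMap.id hy h) (Submodule.mem_sup_right hz)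

theorem span_image_sup_mono {β : Type*} {g : β → T} {A B : Set β} (h : A ⊆ B) {x : T}
    (hx : x ∈ Submodule.span k (g '' A) ⊔ J) : x ∈ Submodule.span k (g '' B) ⊔ J :=
  (sup_le_sup (Submodule.span_mono (Set.image_mono h)) le_rfl : _ ≤ _ ⊔ J) hx

theorem wordElem_mem_normal [Finite ι] (w : List ι) :
    wordElem b w ∈ wordSpan b {z | IsNormalWord b J z} ⊔ J := by
  induction w using above_induction with
  | h w ih =>
    by_cases hw : IsNormalWord b J w
    · exact Submodule.mem_sup_left (wordElem_mem hw)
    · rw [isNormalWord_iff, not_not] at hw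
      exact sup_mono_of_wordSpan hw fun z hz => ih z hz

theorem powerWord_factor {q : List (List ι × ℕ)} {x : List ι × ℕ} (hx : x ∈ q) :
    ∃ p s, powerWord q = p ++ rep x.1 x.2 ++ s := by
  induction q with
  | nil => simp at hx
  | cons y q ih =>
    rcases List.mem_cons.1 hx with rfl | hx
    · exact ⟨powerWord q, [], by simp [powerWord]⟩
    · obtain ⟨p, s, h⟩ := ih hx
      exact ⟨p, s ++ rep y.1 y.2, by simp [powerWord, h]⟩

theorem IsNormalWord.exists_isNormalList (hl : ∀ x, ∀ y ∈ J, x * y ∈ J)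
    (hr : ∀ x, ∀ y ∈ J, y * x ∈ J) {w : List ι} (hw : IsNormalWord b J w) :
    ∃ q, IsNormalList b J q ∧ powerWord q = w := by
  obtain ⟨q, hq, rfl⟩ := exists_powerWord_eq w
  refine ⟨q, ⟨hq, fun x hx => ?_⟩, rfl⟩
  obtain ⟨p, s, h⟩ := powerWord_factor hx
  rw [h] at hw
  exact hw.of_append hl hr

section

variable {d : V ⊗[k] V ≃ₗ[k] V ⊗[k] V} {G : List ι → TensorAlgebra k V}
  (hG : ∀ w, Lyndon w → IsLyndonElement b d w (G w))
include hG

theorem lyndonProd_sub_mem {q : List (List ι × ℕ)} (hq : LyndonList q) :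
    lyndonProd G q - wordElem b (powerWord q) ∈ wordSpan b {z | Above (powerWord q) z} :=
  wordSpan_mono (fun _ hz => above_of_diverges hz.2 hz.1.length_eq)
    (hasLeadingWord_lyndonProd hG hq)

/-- A normal word differs from its Lyndon product by larger words, and a non-normal word is itself a
combination of larger words modulo `J`. Both cases reduce to larger words. -/
theorem wordElem_mem_lyndonProd [Finite ι] (hl : ∀ x, ∀ y ∈ J, x * y ∈ J)
    (hr : ∀ x, ∀ y ∈ J, y * x ∈ J) (w : List ι) :
    wordElem b w ∈ Submodule.span k (lyndonProd G ''
      {q | IsNormalList b J q ∧ (powerWord q = w ∨ Above w (powerWord q))}) ⊔ J := by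
  induction w using above_induction with
  | h w ih =>
    have ih' {x : T} (hx : x ∈ wordSpan b {z | Above w z} ⊔ J) :
        x ∈ Submodule.span k (lyndonProd G ''
          {q | IsNormalList b J q ∧ (powerWord q = w ∨ Above w (powerWord q))}) ⊔ J := by
      refine sup_mono_of_wordSpan hx fun z (hz : Above w z) => ?_
      refine span_image_sup_mono ?_ (ih z hz)
      rintro q ⟨hq, h | h⟩
      · exact ⟨hq, .inr (h ▸ hz)⟩
      · exact ⟨hq, .inr (hz.trans h)⟩
    by_cases hw : IsNormalWord b J w
    · obtain ⟨q, hq, rfl⟩ := hw.exists_isNormalList hl hr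
      rw [← sub_sub_cancel (lyndonProd G q) (wordElem b (powerWord q))]
      exact Submodule.sub_mem _
        (Submodule.mem_sup_left (Submodule.subset_span ⟨q, ⟨hq, .inl rfl⟩, rfl⟩))
        (ih' (Submodule.mem_sup_left (lyndonProd_sub_mem hG hq.1)))
    · rw [isNormalWord_iff, not_not] at hw
      exact ih' hw

/-- Otherwise the Lyndon product of `q` could be rewritten modulo `J` by products with larger words.
Their part of the same length contradicts `lyndonProd_independent`. -/
theorem IsNormalList.isNormalWord [Finite ι] {α : ι → ι → k} (hd : IsLeftTriangular b d α)
    (hl : ∀ x, ∀ y ∈ J, x * y ∈ J) (hr : ∀ x, ∀ y ∈ J, y * x ∈ J)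
    (hJ : ∀ x ∈ J, comul d x ∈ sumTensor J) (h1 : (1 : T) ∉ J) {q : List (List ι × ℕ)}
    (hq : IsNormalList b J q) : IsNormalWord b J (powerWord q) := by
  classical
  by_contra hw
  rw [isNormalWord_iff, not_not] at hw
  have hmem : lyndonProd G q ∈ Submodule.span k (lyndonProd G ''
      {q' | IsNormalList b J q' ∧ Above (powerWord q) (powerWord q')}) ⊔ J := by
    have h2 : lyndonProd G q ∈ wordSpan b {z | Above (powerWord q) z} ⊔ J := by
      rw [← sub_add_cancel (lyndonProd G q) (wordElem b (powerWord q))]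
      exact Submodule.add_mem _ (Submodule.mem_sup_left (lyndonProd_sub_mem hG hq.1)) hw
    refine sup_mono_of_wordSpan h2 fun z (hz : Above _ z) => ?_
    refine span_image_sup_mono ?_
      (wordElem_mem_lyndonProd hG hl hr z)
    rintro q' ⟨hq', h | h⟩
    · exact ⟨hq', h ▸ hz⟩
    · exact ⟨hq', hz.trans h⟩
  obtain ⟨y, hy, z, hz, e⟩ := Submodule.mem_sup.1 hmem
  obtain ⟨l, hlS, rfl⟩ := (Finsupp.mem_span_image_iff_linearCombination k).1 hy
  have hsupp (q') (h : q' ∈ l.support) :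
      IsNormalList b J q' ∧ Above (powerWord q) (powerWord q') := hlS h
  have hq0 : q ∉ l.support := fun h => not_above_self _ (hsupp q h).2
  -- The coefficient -1 at `q` moves its product to the other side. The products of shorter words
  -- are absorbed by the terms of lower degree.
  have hind := lyndonProd_independent hd hG hJ h1 (powerWord q).length
    (insert q (l.support.filter fun q' => (powerWord q').length = (powerWord q).length))
    (fun q' => if q' = q then -1 else l q') ?_ ?_ q (Finset.mem_insert_self _ _)
  · simp at hind
  · intro q' hq'
    rcases Finset.mem_insert.1 hq' with rfl | hq'
    · exact ⟨hq, rfl⟩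
    · exact ⟨(hsupp q' (Finset.mem_filter.1 hq').1).1, (Finset.mem_filter.1 hq').2⟩
  · rw [Finset.sum_insert fun h => hq0 (Finset.mem_filter.1 h).1, if_pos rfl]
    have h3 : ∑ q' ∈ l.support.filter (fun q' => (powerWord q').length = (powerWord q).length),
        (if q' = q then -1 else l q') • lyndonProd G q' =
        ∑ q' ∈ l.support.filter (fun q' => (powerWord q').length = (powerWord q).length),
          l q' • lyndonProd G q' := by
      refine Finset.sum_congr rfl fun q' hq' => ?_
      rw [if_neg]
      rintro rfl
      exact hq0 (Finset.mem_filter.1 hq').1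
    have h4 : Finsupp.linearCombination k (lyndonProd G) l =
        ∑ q' ∈ l.support.filter (fun q' => (powerWord q').length = (powerWord q).length),
          l q' • lyndonProd G q' +
        ∑ q' ∈ l.support.filter (fun q' => ¬(powerWord q').length = (powerWord q).length),
          l q' • lyndonProd G q' := by
      rw [Finset.sum_filter_add_sum_filter_not]; rfl
    have h5 : ∑ q' ∈ l.support.filter (fun q' => ¬(powerWord q').length = (powerWord q).length),
        l q' • lyndonProd G q' ∈ wordSpan b {t | t.length < (powerWord q).length} := by
      refine Submodule.sum_mem _ fun q' hq' => Submodule.smul_mem _ _ ?_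
      obtain ⟨h6, h7⟩ := Finset.mem_filter.1 hq'
      obtain ⟨h8, h9⟩ := hsupp q' h6
      refine wordSpan_mono ?_ (hasLeadingWord_lyndonProd hG h8.1).mem_length
      rintro t (ht : t.length = _)
      exact (show t.length < _ from ht ▸ h9.resolve_right fun h => h7 h.1)
    rw [h3, ← e, h4]
    convert Submodule.neg_mem _ (Submodule.add_mem_sup h5 hz) using 1
    module

end

theorem wordElem_injective : Function.Injective (wordElem b) :=
  b.tensorAlgebra.injective.comp FreeMonoid.ofList.injective

/-- Normality passes from a power to all smaller ones, so the first failure determines every later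
one. -/
theorem lt_height_iff (hl : ∀ x, ∀ y ∈ J, x * y ∈ J) (hr : ∀ x, ∀ y ∈ J, y * x ∈ J)
    {v : List ι} {n : ℕ} (hn : 0 < n) :
    (n : ℕ∞) < height b J (wordElem b v) ↔ IsNormalWord b J (rep v n) := by
  have hpow (n : ℕ) : FreeMonoid.ofList v ^ n = FreeMonoid.ofList (rep v n) := by
    induction n with
    | zero => rfl
    | succ n ih => rw [pow_succ', ih, rep_succ, FreeMonoid.ofList_append]
  have hheight : height b J (wordElem b v) = wordHeight b J (FreeMonoid.ofList v) := by
    refine le_antisymm (iInf_le_of_le (FreeMonoid.ofList v) (iInf_le_of_le rfl le_rfl))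
      (le_iInf fun u => le_iInf fun hu => ?_)
    rw [b.tensorAlgebra.injective hu]
  rw [hheight, wordHeight]
  constructor
  · intro h hmem
    refine (sInf_le (a := (n : ℕ∞)) ?_).not_gt h
    refine ⟨n, hn, rfl, ?_⟩
    rw [hpow]
    exact hmem
  · intro h
    refine lt_of_lt_of_le (b := ((n + 1 : ℕ) : ℕ∞)) (by exact_mod_cast n.lt_succ_self)
      (le_sInf ?_)
    rintro _ ⟨m, hm, rfl, hmem⟩
    rw [hpow] at hmem
    by_contra hlt
    have hmn : m ≤ n := by
      have : m < n + 1 := by exact_mod_cast not_le.1 hlt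
      omega
    exact h.of_rep hl hr hmn hmem

theorem elemLexLT_wordElem {u v : List ι} :
    ElemLexLT b (wordElem b u) (wordElem b v) ↔ u < v := by
  constructor
  · rintro ⟨u', v', hu, hv, h⟩
    rw [b.tensorAlgebra.injective hu, b.tensorAlgebra.injective hv] at h
    exact h
  · exact fun h => ⟨_, _, rfl, rfl, h⟩

theorem mem_hardWords {x : T} :
    x ∈ hardWords b J ↔ ∃ v, Lyndon v ∧ IsNormalWord b J v ∧ wordElem b v = x :=
  ⟨fun ⟨v, ⟨h1, h2⟩, h⟩ => ⟨v, h1, h2, h⟩, fun ⟨v, h1, h2, h⟩ => ⟨v, ⟨h1, h2⟩, h⟩⟩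

/-- A linear combination of normal words that lies in `J` is trivial. -/
theorem normalWords_independent {l : List ι →₀ k} (hl : ∀ w ∈ l.support, IsNormalWord b J w)
    (h : Finsupp.linearCombination k (wordElem b) l ∈ J) : l = 0 := by
  classical
  by_contra h0
  obtain ⟨u, hu, hmax⟩ := l.support.exists_max_image
    (fun w => (toLex (w.length, OrderDual.toDual w) : Lex (ℕ × (List ι)ᵒᵈ)))
    (Finsupp.support_nonempty_iff.2 h0)
  refine hl u hu ?_
  have habove (z) (hz : z ∈ l.support.erase u) : Above u z := by
    obtain ⟨hne, hz⟩ := Finset.mem_erase.1 hz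
    have := hmax z hz
    simp only [Prod.Lex.toLex_le_toLex, OrderDual.toDual_le_toDual] at this
    rcases this with h | ⟨h, h'⟩
    · exact .inl h
    · exact .inr ⟨h, lt_of_le_of_ne h' (Ne.symm hne)⟩
  have hsplit : Finsupp.linearCombination k (wordElem b) l =
      ∑ z ∈ l.support.erase u, l z • wordElem b z + l u • wordElem b u := by
    rw [Finset.sum_erase_add _ _ hu]; rfl
  have hlu : l u ≠ 0 := Finsupp.mem_support_iff.1 hu
  rw [← Submodule.smul_mem_iff _ hlu, spanAbove_eq_wordSpan]
  have : l u • wordElem b u = -∑ z ∈ l.support.erase u, l z • wordElem b z +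
      Finsupp.linearCombination k (wordElem b) l := by rw [hsplit]; abel
  rw [this]
  exact Submodule.add_mem_sup (Submodule.neg_mem _ (Submodule.sum_mem _ fun z hz =>
    Submodule.smul_mem _ _ (wordElem_mem (habove z hz)))) h

end NormalWords

/-! ### From normal words to PBW sets -/

noncomputable section PBWSets

variable {k V ι : Type*} [Field k] [AddCommGroup V] [Module k V] [LinearOrder ι]

local notation "T" => TensorAlgebra k V

theorem map_comm_reversal_mem_sumTensor {I : Submodule k T} {X : T ⊗[k] T}
    (hX : X ∈ sumTensor I) :
    TensorProduct.comm k T T (TensorProduct.map reversal reversal X) ∈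
      sumTensor (I.map reversal) := by
  have hl (Y : T ⊗[k] I) : TensorProduct.comm k T T (TensorProduct.map reversal reversal
      (I.subtype.lTensor T Y)) ∈ sumTensor (I.map reversal) := by
    induction Y using TensorProduct.induction_on with
    | zero => simp
    | tmul x y =>
      exact Submodule.mem_sup_right
        ⟨(⟨reversal y, Submodule.mem_map_of_mem y.2⟩ : I.map reversal) ⊗ₜ[k] reversal x, rfl⟩
    | add x y hx hy => simpa only [map_add] using Submodule.add_mem _ hx hy
  have hr (Z : I ⊗[k] T) : TensorProduct.comm k T T (TensorProduct.map reversal reversal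
      (I.subtype.rTensor T Z)) ∈ sumTensor (I.map reversal) := by
    induction Z using TensorProduct.induction_on with
    | zero => simp
    | tmul x y =>
      exact Submodule.mem_sup_left
        ⟨reversal y ⊗ₜ[k] (⟨reversal x, Submodule.mem_map_of_mem x.2⟩ : I.map reversal), rfl⟩
    | add x y hx hy => simpa only [map_add] using Submodule.add_mem _ hx hy
  obtain ⟨_, ⟨Y, rfl⟩, _, ⟨Z, rfl⟩, rfl⟩ := Submodule.mem_sup.1 hX
  rw [map_add, map_add]
  exact Submodule.add_mem _ (hl Y) (hr Z)

theorem reversal_listProd (b : Module.Basis ι k V) {S : Set T} (f : S → List ι)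
    (hf : ∀ s : S, wordElem b (f s) = reversal (s : T)) (l : List (S × ℕ)) :
    reversal (l.map fun x => (x.1 : T) ^ x.2).prod =
      wordElem b (powerWord (l.map fun x => (f x.1, x.2))) := by
  have hrep (v : List ι) (n : ℕ) : wordElem b (rep v n) = wordElem b v ^ n := by
    induction n with
    | zero => simp
    | succ n ih => rw [rep_succ, wordElem_append, ih, pow_succ']
  induction l with
  | nil => simp [powerWord]
  | cons x l ih =>
    rw [List.map_cons, List.prod_cons, reversal_mul, ih, reversal_pow, List.map_cons, powerWord,
      wordElem_append, hrep, hf]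

theorem exists_map_eq {α β : Type*} {f : α → β} {l : List β} (h : ∀ y ∈ l, ∃ x, f x = y) :
    ∃ l', List.map f l' = l := by
  induction l with
  | nil => exact ⟨[], rfl⟩
  | cons y l ih =>
    obtain ⟨x, rfl⟩ := h y (by simp)
    obtain ⟨l', rfl⟩ := ih fun y hy => h y (List.mem_cons_of_mem _ hy)
    exact ⟨x :: l', rfl⟩

/-- Reversal moves the first factor, which is largest in `S` and has the smallest reversed word, to
the end. There `powerWord` places the head of its list, so PBW products correspond to lists of
normal powers, and these to normal words. -/
theorem pbwSet_eq_image {b : Module.Basis ι k V} {J : Submodule k T}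
    (hl : ∀ x, ∀ y ∈ J, x * y ∈ J) (hr : ∀ x, ∀ y ∈ J, y * x ∈ J)
    (hN : ∀ q, IsNormalList b J q → IsNormalWord b J (powerWord q))
    {S : Set T} {lt : S → S → Prop} {h : S → ℕ∞} (hS : S = reversal ⁻¹' hardWords b J)
    (hlt : ∀ s t : S, lt s t ↔ ElemLexLT b (reversal (t : T)) (reversal (s : T)))
    (hh : ∀ s : S, h s = height b J (reversal (s : T))) :
    pbwSet {1} S lt h = (fun w => reversal (wordElem b w)) '' {w | IsNormalWord b J w} := by
  have hS' (s : S) : ∃ v, (Lyndon v ∧ IsNormalWord b J v) ∧ wordElem b v = reversal (s : T) := by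
    obtain ⟨v, h1, h2, h3⟩ := mem_hardWords.1 (hS.subset s.2)
    exact ⟨v, ⟨h1, h2⟩, h3⟩
  choose f hf1 hf2 using hS'
  have hlt' (s t : S) : lt s t ↔ f t < f s := by rw [hlt, ← hf2, ← hf2, elemLexLT_wordElem]
  have hh' (s : S) {n : ℕ} (hn : 0 < n) : (n : ℕ∞) < h s ↔ IsNormalWord b J (rep (f s) n) := by
    rw [hh, ← hf2, lt_height_iff hl hr hn]
  ext a
  constructor
  · rintro ⟨l, _, rfl, h1, h2, rfl⟩
    refine ⟨powerWord (l.map fun x => (f x.1, x.2)), hN _ ⟨⟨?_, ?_⟩, ?_⟩, ?_⟩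
    · exact List.pairwise_map.2 (h1.imp fun {x y} hxy => (hlt' _ _).1 hxy)
    · intro x hx
      obtain ⟨y, hy, rfl⟩ := List.mem_map.1 hx
      exact ⟨(hf1 y.1).1, (h2 y hy).1⟩
    · intro x hx
      obtain ⟨y, hy, rfl⟩ := List.mem_map.1 hx
      exact (hh' y.1 (h2 y hy).1).1 (h2 y hy).2
    · simp only
      rw [← reversal_listProd b f hf2, reversal_reversal, mul_one]
  · rintro ⟨w, hw, rfl⟩
    obtain ⟨q, hq, rfl⟩ := hw.exists_isNormalList hl hr
    obtain ⟨l, rfl⟩ : ∃ l : List (S × ℕ), l.map (fun x => (f x.1, x.2)) = q := by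
      refine exists_map_eq fun x hx => ?_
      obtain ⟨hx1, hx2⟩ := hq.1.2 x hx
      -- A generator needs its first power to be normal; this follows from the normality of a
      -- positive power.
      have hx3 : IsNormalWord b J x.1 := by
        simpa using (hq.2 x hx).of_rep hl hr (m := 1) hx2
      refine ⟨(⟨reversal (wordElem b x.1), ?_⟩, x.2), ?_⟩
      · rw [hS, Set.mem_preimage, reversal_reversal, mem_hardWords]
        exact ⟨x.1, hx1, hx3, rfl⟩
      · refine Prod.ext (wordElem_injective (b := b) ?_) rfl
        simp only
        rw [hf2, reversal_reversal]
    refine ⟨l, 1, rfl, ?_, fun x hx => ?_, ?_⟩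
    · exact (List.pairwise_map.1 hq.1.1).imp fun {x y} hxy => (hlt' _ _).2 hxy
    · have hmem := List.mem_map_of_mem (f := fun x : S × ℕ => (f x.1, x.2)) hx
      have h1 := (hq.1.2 _ hmem).2
      exact ⟨h1, (hh' x.1 h1).2 (hq.2 _ hmem)⟩
    · simp only
      rw [← reversal_listProd b f hf2, reversal_reversal, mul_one]

theorem isStrictTotalOrder_of_elemLexLT {b : Module.Basis ι k V} {J : Submodule k T}
    {S : Set T} {lt : S → S → Prop} (hS : S = reversal ⁻¹' hardWords b J)
    (hlt : ∀ s t : S, lt s t ↔ ElemLexLT b (reversal (t : T)) (reversal (s : T))) :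
    IsStrictTotalOrder S lt := by
  have hS' (s : S) : ∃ v, wordElem b v = reversal (s : T) := by
    obtain ⟨v, -, -, h3⟩ := mem_hardWords.1 (hS.subset s.2)
    exact ⟨v, h3⟩
  choose f hf using hS'
  have hinj : Function.Injective f := fun s t h => by
    refine Subtype.ext (reversal_bijective.1 ?_)
    rw [← hf, ← hf, h]
  let e : lt ↪r ((· > ·) : List ι → List ι → Prop) :=
    ⟨⟨f, hinj⟩, fun {s t} => by
      rw [hlt, ← hf, ← hf, elemLexLT_wordElem]; rfl⟩
  exact e.isStrictTotalOrder

theorem pbwSet_image {A B : Type*} [Ring A] [Ring B] [Algebra k A] [Algebra k B]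
    (π : A →ₐ[k] B) {S : Set A} (lt : S → S → Prop) (h : S → ℕ∞)
    (e : S ≃ (π '' S : Set B)) (he : ∀ s : S, (e s : B) = π s) :
    pbwSet {1} (π '' S) (fun x y => lt (e.symm x) (e.symm y)) (fun x => h (e.symm x)) =
      π '' pbwSet {1} S lt h := by
  ext a
  constructor
  · rintro ⟨l, _, rfl, h1, h2, rfl⟩
    refine ⟨_, ⟨l.map fun x => (e.symm x.1, x.2), 1, rfl, List.pairwise_map.2 h1,
      fun x hx => ?_, rfl⟩, ?_⟩
    · obtain ⟨y, hy, rfl⟩ := List.mem_map.1 hx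
      exact h2 y hy
    · simp only [map_mul, map_one, map_list_prod, List.map_map, Function.comp_def, map_pow, ← he,
        Equiv.apply_symm_apply]
  · rintro ⟨_, ⟨l, _, rfl, h1, h2, rfl⟩, rfl⟩
    refine ⟨l.map fun x => (e x.1, x.2), 1, rfl, List.pairwise_map.2 ?_, fun x hx => ?_, ?_⟩
    · simpa using h1
    · obtain ⟨y, hy, rfl⟩ := List.mem_map.1 hx
      simpa using h2 y hy
    · simp only [map_mul, map_one, map_list_prod, List.map_map, Function.comp_def, map_pow, ← he]

end PBWSets

end BraidedPBW

/-! ### The PBW basis of the quotient by a braided biideal -/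

theorem mainTheorem3 {k V ι : Type*} [Field k] [AddCommGroup V] [Module k V]
    [Fintype ι] [LinearOrder ι] (b : Module.Basis ι k V)
    (c : V ⊗[k] V ≃ₗ[k] V ⊗[k] V) (hc : BraidedPBW.BraidEquation c)
    (htri : BraidedPBW.IsRightTriangular b c)
    (I : Ideal (TensorAlgebra k V)) [I.IsTwoSided]
    (hI : BraidedPBW.IsBraidedBiideal c I) (hne : I ≠ ⊤) :
    -- the word-reversing isomorphism of braided bialgebras
    BraidedPBW.IsIsoToOpCop c (BraidedPBW.reversal (k := k) (V := V)) ∧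
    (∀ l : List V, BraidedPBW.reversal (l.map (TensorAlgebra.ι k)).prod =
      (l.reverse.map (TensorAlgebra.ι k)).prod) ∧
    -- the PBW basis
    ∃ (S : Set (TensorAlgebra k V)) (lt : S → S → Prop) (h : S → ℕ∞),
      S = BraidedPBW.reversal ⁻¹'
        BraidedPBW.hardWords b ((I.restrictScalars k).map BraidedPBW.reversal) ∧
      (∀ s t : S, lt s t ↔
        BraidedPBW.ElemLexLT b (BraidedPBW.reversal (t : TensorAlgebra k V))
          (BraidedPBW.reversal (s : TensorAlgebra k V))) ∧
      (∀ s : S, h s = BraidedPBW.height b ((I.restrictScalars k).map BraidedPBW.reversal)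
        (BraidedPBW.reversal (s : TensorAlgebra k V))) ∧
      IsStrictTotalOrder S lt ∧
      -- the residue classes of the elements of the PBW set form a basis of the quotient
      LinearIndepOn k (Ideal.Quotient.mkₐ k I) (BraidedPBW.pbwSet {1} S lt h) ∧
      Submodule.span k (Ideal.Quotient.mkₐ k I '' BraidedPBW.pbwSet {1} S lt h) = ⊤ ∧
      -- the quotient has the PBW basis generated by the residue classes of `S`
      ∃ e : S ≃ (Ideal.Quotient.mkₐ k I '' S : Set (TensorAlgebra k V ⧸ I)),
        (∀ s : S, (e s : TensorAlgebra k V ⧸ I) = Ideal.Quotient.mkₐ k I (s : TensorAlgebra k V)) ∧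
        BraidedPBW.IsPBWBasis k {1} (Ideal.Quotient.mkₐ k I '' S)
          (fun x y => lt (e.symm x) (e.symm y)) (fun x => h (e.symm x)) := by
  open BraidedPBW in
  obtain ⟨α, hd⟩ := htri.exists_isLeftTriangular
  set J := (I.restrictScalars k).map (reversal (k := k) (V := V)) with hJdef
  have memJ {x : TensorAlgebra k V} : x ∈ J ↔ reversal x ∈ I := by
    constructor
    · rintro ⟨y, hy, rfl⟩
      rw [reversal_reversal]; exact hy
    · exact fun h => ⟨reversal x, h, reversal_reversal x⟩
  have hl : ∀ x, ∀ y ∈ J, x * y ∈ J := fun x y hy => by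
    rw [memJ] at *
    rw [reversal_mul]
    exact I.mul_mem_right _ hy
  have hr : ∀ x, ∀ y ∈ J, y * x ∈ J := fun x y hy => by
    rw [memJ] at *
    rw [reversal_mul]
    exact I.mul_mem_left _ hy
  have h1 : (1 : TensorAlgebra k V) ∉ J := fun h => by
    rw [memJ, reversal_one] at h
    exact hne ((Ideal.eq_top_iff_one I).2 h)
  have hJ : ∀ x ∈ J, comul (flipConj c) x ∈ sumTensor J := by
    rintro _ ⟨y, hy, rfl⟩
    rw [← comm_comm_apply (comul (flipConj c) (reversal y)), ← map_reversal_comul]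
    exact map_comm_reversal_mem_sumTensor (hI.comul_mem y hy)
  have hG (w : List ι) : ∃ g, Lyndon w → IsLyndonElement b (flipConj c) w g := by
    by_cases hw : Lyndon w
    · obtain ⟨g, hg⟩ := hd.exists_isLyndonElement hw
      exact ⟨g, fun _ => hg⟩
    · exact ⟨0, fun h => absurd h hw⟩
  choose G hG using hG
  have hN (q) (hq : IsNormalList b J q) := hq.isNormalWord hG hd hl hr hJ h1
  refine ⟨isIsoToOpCop_reversal c, reversal_prod, reversal ⁻¹' hardWords b J,
    fun s t => ElemLexLT b (reversal (t : TensorAlgebra k V)) (reversal (s : TensorAlgebra k V)),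
    fun s => height b J (reversal (s : TensorAlgebra k V)), rfl, fun _ _ => Iff.rfl,
    fun _ => rfl, ?_⟩
  set S := reversal ⁻¹' hardWords b J with hS
  set lt : S → S → Prop := fun s t =>
    ElemLexLT b (reversal (t : TensorAlgebra k V)) (reversal (s : TensorAlgebra k V))
  set h : S → ℕ∞ := fun s => height b J (reversal (s : TensorAlgebra k V))
  have hord : IsStrictTotalOrder S lt := isStrictTotalOrder_of_elemLexLT hS fun _ _ => Iff.rfl
  have hset := pbwSet_eq_image hl hr hN hS (lt := lt) (h := h) (fun _ _ => Iff.rfl)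
    (fun _ => rfl)
  have hπ {x : TensorAlgebra k V} : Ideal.Quotient.mkₐ k I x = 0 ↔ x ∈ I :=
    Ideal.Quotient.eq_zero_iff_mem
  have hind : LinearIndepOn k (Ideal.Quotient.mkₐ k I) (pbwSet {1} S lt h) := by
    rw [hset]
    refine LinearIndepOn.image_of_comp (fun w => reversal (wordElem b w)) _
      (linearIndepOn_iff.2 fun l hls hl0 => normalWords_independent (b := b) (J := J)
        (fun w hw => hls hw) ?_)
    rw [memJ, ← hπ, ← hl0, Finsupp.linearCombination_apply, Finsupp.linearCombination_apply,
      map_finsuppSum, map_finsuppSum]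
    simp
  have hspan : Submodule.span k (Ideal.Quotient.mkₐ k I '' pbwSet {1} S lt h) = ⊤ := by
    rw [eq_top_iff, hset]
    rintro x -
    obtain ⟨x, rfl⟩ := Ideal.Quotient.mkₐ_surjective k I x
    rw [← reversal_reversal x]
    have hx : reversal x ∈ Submodule.span k (Set.range b.tensorAlgebra) := by
      rw [b.tensorAlgebra.span_eq]; trivial
    refine map_mem_of_mem_span ((Ideal.Quotient.mkₐ k I).toLinearMap ∘ₗ reversal) hx ?_
    rintro _ ⟨w, rfl⟩
    obtain ⟨y, hy, z, hz, e⟩ := Submodule.mem_sup.1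
      (wordElem_mem_normal (b := b) (J := J) (FreeMonoid.toList w))
    have e' : y + z = b.tensorAlgebra w := e
    rw [← e', map_add]
    refine Submodule.add_mem _ (map_mem_of_wordSpan _ hy fun u hu => ?_) ?_
    · exact Submodule.subset_span ⟨_, ⟨u, hu, rfl⟩, rfl⟩
    · have : ((Ideal.Quotient.mkₐ k I).toLinearMap ∘ₗ reversal) z = 0 := hπ.2 (memJ.1 hz)
      rw [this]
      exact Submodule.zero_mem _
  -- Each generator is the reversal of a normal word and so lies in the PBW set, on which the
  -- quotient map is injective. This makes `e` a bijection.
  have hSsub : S ⊆ pbwSet {1} S lt h := by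
    rw [hset]
    intro s hs
    obtain ⟨v, -, hv, hvs⟩ := mem_hardWords.1 hs
    exact ⟨v, hv, by simp only; rw [hvs, reversal_reversal]⟩
  let e : S ≃ (Ideal.Quotient.mkₐ k I '' S : Set (TensorAlgebra k V ⧸ I)) :=
    Equiv.Set.imageOfInjOn _ S (hind.injOn.mono hSsub)
  have he (s : S) : (e s : TensorAlgebra k V ⧸ I) =
      Ideal.Quotient.mkₐ k I (s : TensorAlgebra k V) := rfl
  refine ⟨hord, hind, hspan, e, he, ?_, ?_, ?_⟩
  · let r : (fun x y => lt (e.symm x) (e.symm y)) ↪r lt := ⟨e.symm.toEmbedding, Iff.rfl⟩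
    exact r.isStrictTotalOrder
  · rw [pbwSet_image _ lt h e he]
    exact hind.id_image
  · rw [pbwSet_image _ lt h e he]
    exact hspan
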